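/- **Frame Ricci identities in $n\ge 3$ dimensions.** Let $(M,g)$ be a smooth $n$-dimensional Lorentzian manifold of signature $(-,+,\dots,+)$, $n\ge 3$, with Levi-Civita connection $\nabla$, and let $(\ell,n,m^{(i)})$, $i=2,\dots,n-1$, be a smooth null frame on an open set $U\subseteq M$: $\ell\cdot\ell=n\cdot n=\ell\cdot m^{(i)}=n\cdot m^{(i)}=0$, $\ell\cdot n=1$, $m^{(i)}\cdot m^{(j)}=\delta_{ij}$. Indices $a,b,c,s$ run over $0,\dots,n-1$ and $i,j,k,l,p$ over $2,\dots,n-1$; a lower frame index $0$, $1$, $i$ denotes contraction with $\ell$, $n$, $m^{(i)}$ respectively. Let $L_{ab}$, $N_{ab}$, $\overset{i}{M}_{ab}$ be the frame components of $\ell_{a;b}$, $n_{a;b}$, $m^{(i)}_{a;b}$ (for instance $L_{10}=\ell_{a;b}n^a\ell^b$), and let $D=\ell^a\nabla_a$, $\Delta=n^a\nabla_a$, $\delta_i=m^{(i)a}\nabla_a$. The Riemann tensor is given by $v_{a;bc}-v_{a;cb}=R_{sabc}v^s$, i.e. $R_{sabc}S^sA^aB^bC^c=g\big((\nabla_C\nabla_B-\nabla_B\nabla_C-\nabla_{[C,B]})S,A\big)$;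 $R_{ab}=R^{c}{}_{acb}$, $R=R^a{}_a$, and the Weyl tensor is $$C_{abcd}=R_{abcd}-\tfrac1{n-2}\left(g_{ac}R_{bd}-g_{ad}R_{bc}-g_{bc}R_{ad}+g_{bd}R_{ac}\right)+\tfrac{R}{(n-1)(n-2)}\left(g_{ac}g_{bd}-g_{ad}g_{bc}\right).$$ Repeated indices are summed, $T_{[ab]}=\frac12(T_{ab}-T_{ba})$, and indices between vertical bars are not antisymmetrized. Then the rotation coefficients $L_{ab},N_{ab},\overset{i}{M}_{ab}$ are smooth on $U$, the Ricci identities $v_{a;bc}-v_{a;cb}=R_{sabc}v^s$ hold on $U$ for each frame vector $v$, and at every point of $U$: 1. $DL_{11}-\Delta L_{10}=-2L_{10}L_{11}-L_{1i}L_{i1}+N_{i0}(L_{1i}+L_{i1})-L_{i0}N_{i1}-C_{0101}+\frac{2}{n-2}R_{01}-\frac{1}{(n-1)(n-2)}R$ 2. $DL_{1i}-\delta_iL_{10}=-L_{11}L_{i0}-L_{10}(L_{1i}+N_{i0})+2L_{j[i|}N_{j|0]}-L_{1j}(L_{ji}+\overset{j}{M}_{i0})-C_{010i}+\frac{1}{n-2}R_{0i}$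 3. $\Delta L_{1i}-\delta_iL_{11}=-L_{10}N_{i1}+L_{11}(L_{1i}-L_{i1})-2L_{j[1|}N_{j|i]}-L_{1j}(N_{ji}+\overset{j}{M}_{i1})+C_{101i}-\frac{1}{n-2}R_{1i}$ 4. $\delta_{[j|}L_{1|i]}=-L_{11}L_{[ij]}-L_{10}N_{[ij]}-L_{1k}\overset{k}{M}_{[ij]}-L_{k[j|}N_{k|i]}+\frac12C_{01ij}$ 5. $DL_{i1}-\Delta L_{i0}=-2L_{11}L_{i0}+L_{ij}(-L_{j1}+N_{j0})+2L_{j[0|}\overset{j}{M}_{i|1]}-C_{010i}+\frac{1}{n-2}R_{0i}$ 6. $\Delta N_{i0}-DN_{i1}=2L_{10}N_{i1}+N_{ij}(-N_{j0}+L_{j1})+2N_{j[1|}\overset{j}{M}_{i|0]}-C_{101i}+\frac{1}{n-2}R_{1i}$ 7. $DL_{ij}-\delta_jL_{i0}=L_{10}L_{ij}-L_{i0}(2L_{1j}+N_{j0})-L_{i1}L_{j0}+2L_{k[0|}\overset{k}{M}_{i|j]}-L_{ik}(L_{kj}+\overset{k}{M}_{j0})-C_{0i0j}-\frac{1}{n-2}R_{00}\delta_{ij}$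 8. $\Delta N_{ij}-\delta_jN_{i1}=-L_{11}N_{ij}-N_{i1}(-2L_{1j}+L_{j1})-N_{i0}N_{j1}+2N_{k[1|}\overset{k}{M}_{i|j]}-N_{ik}(N_{kj}+\overset{k}{M}_{j1})-C_{1i1j}-\frac{1}{n-2}R_{11}\delta_{ij}$ 9. $\Delta L_{ij}-\delta_jL_{i1}=L_{11}L_{ij}-L_{i1}L_{j1}-L_{i0}N_{j1}+2L_{k[1|}\overset{k}{M}_{i|j]}-L_{ik}(N_{kj}+\overset{k}{M}_{j1})-C_{0i1j}-\frac{1}{n-2}(R_{ij}+R_{01}\delta_{ij})+\frac{1}{(n-1)(n-2)}R\,\delta_{ij}$ 10. $DN_{ij}-\delta_jN_{i0}=-L_{10}N_{ij}-N_{i0}N_{j0}-N_{i1}L_{j0}+2N_{k[0|}\overset{k}{M}_{i|j]}-N_{ik}(L_{kj}+\overset{k}{M}_{j0})-C_{0j1i}-\frac{1}{n-2}(R_{ij}+R_{01}\delta_{ij})+\frac{1}{(n-1)(n-2)}R\,\delta_{ij}$ 11. $\delta_{[j|}L_{i|k]}=L_{1[j|}L_{i|k]}+L_{i1}L_{[jk]}+L_{i0}N_{[jk]}+L_{il}\overset{l}{M}_{[jk]}+L_{l[j|}\overset{l}{M}_{i|k]}-\frac12C_{0ijk}-\frac{1}{n-2}R_{0[j}\delta_{k]i}$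 12. $\delta_{[j|}N_{i|k]}=-L_{1[j|}N_{i|k]}+N_{i0}N_{[jk]}+N_{i1}L_{[jk]}+N_{il}\overset{l}{M}_{[jk]}+N_{l[j|}\overset{l}{M}_{i|k]}-\frac12C_{1ijk}-\frac{1}{n-2}R_{1[j}\delta_{k]i}$ 13. $D\overset{i}{M}_{j1}-\Delta\overset{i}{M}_{j0}=2N_{i[1|}L_{j|0]}+2L_{i[1|}N_{j|0]}-L_{10}\overset{i}{M}_{j1}-L_{11}\overset{i}{M}_{j0}+2\overset{i}{M}_{k[0|}\overset{k}{M}_{j|1]}+\overset{i}{M}_{jk}(-L_{k1}+N_{k0})-C_{01ij}$ 14. $D\overset{i}{M}_{jk}-\delta_k\overset{i}{M}_{j0}=2L_{j[0|}N_{i|k]}+2N_{j[0|}L_{i|k]}-L_{k0}\overset{i}{M}_{j1}-\overset{i}{M}_{j0}(L_{1k}+N_{k0})+2\overset{i}{M}_{l[0|}\overset{l}{M}_{j|k]}-\overset{i}{M}_{jl}(L_{lk}+\overset{l}{M}_{k0})-C_{0kij}-\frac{2}{n-2}R_{0[i}\delta_{j]k}$ 15. $\Delta\overset{i}{M}_{jk}-\delta_k\overset{i}{M}_{j1}=2N_{j[1|}L_{i|k]}+2L_{j[1|}N_{i|k]}-N_{k1}\overset{i}{M}_{j0}+\overset{i}{M}_{j1}(L_{1k}-L_{k1})+2\overset{i}{M}_{l[1|}\overset{l}{M}_{j|k]}-\overset{i}{M}_{jl}(N_{lk}+\overset{l}{M}_{k1})-C_{1kij}-\frac{2}{n-2}R_{1[i}\delta_{j]k}$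 16. $\delta_{[k|}\overset{i}{M}_{j|l]}=N_{i[l|}L_{j|k]}+L_{i[l|}N_{j|k]}+L_{[kl]}\overset{i}{M}_{j1}+N_{[kl]}\overset{i}{M}_{j0}+\overset{i}{M}_{p[k|}\overset{p}{M}_{j|l]}+\overset{i}{M}_{jp}\overset{p}{M}_{[kl]}-\frac12C_{ijkl}-\frac{1}{n-2}\left(\delta_{i[k}R_{l]j}-\delta_{j[k}R_{l]i}\right)+\frac{1}{(n-1)(n-2)}R\,\delta_{i[k}\delta_{l]j}$ Moreover, this system is complete, i.e. further contractions of the Ricci identities give nothing new: at every $x\in U$, for every array $\rho_{sabc}$ of numbers with the algebraic symmetries of a Riemann tensor, all the identities $v_{a;bc}-v_{a;cb}=\rho_{sabc}v^s$ (for $v$ each of the frame vectors, contracted with all triples of frame vectors) hold at $x$ if and only if the sixteen equations hold at $x$ with $C_{abcd}$, $R_{ab}$, $R$ replaced by the Weyl, Ricci and scalar parts of $\rho$. -/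

import Mathlib

open scoped Manifold ContDiff Topology

noncomputable section

namespace HDNP

variable {E : Type*} [NormedAddCommGroup E] [NormedSpace ℝ E]
  {M : Type*} [TopologicalSpace M] [ChartedSpace E M] [IsManifold 𝓘(ℝ, E) ∞ M]

/-- A vector field on `M` (no regularity is part of the type). -/
abbrev VField (E : Type*) [NormedAddCommGroup E] [NormedSpace ℝ E]
    (M : Type*) [TopologicalSpace M] [ChartedSpace E M] : Type _ :=
  (x : M) → TangentSpace 𝓘(ℝ, E) x

/-- A smooth Lorentzian metric of signature `(-, +, …, +)` on the manifold `M` modelled on `E`. -/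
structure LorentzMetric (E : Type*) [NormedAddCommGroup E] [NormedSpace ℝ E]
    (M : Type*) [TopologicalSpace M] [ChartedSpace E M] [IsManifold 𝓘(ℝ, E) ∞ M] where
  /-- the metric as a bilinear form on each tangent space -/
  val : (x : M) → TangentSpace 𝓘(ℝ, E) x →L[ℝ] TangentSpace 𝓘(ℝ, E) x →L[ℝ] ℝ
  symm : ∀ (x : M) (v w : TangentSpace 𝓘(ℝ, E) x), val x v w = val x w v
  /-- every tangent space has a timelike vector whose orthogonal complement is positive definite -/
  signature : ∀ x : M, ∃ u : TangentSpace 𝓘(ℝ, E) x, val x u u < 0 ∧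
    ∀ v : TangentSpace 𝓘(ℝ, E) x, val x u v = 0 → v ≠ 0 → 0 < val x v v
  contMDiff : ContMDiff 𝓘(ℝ, E) (𝓘(ℝ, E).prod 𝓘(ℝ, E →L[ℝ] E →L[ℝ] ℝ)) ∞
    (fun x : M ↦ Bundle.TotalSpace.mk' (E →L[ℝ] E →L[ℝ] ℝ)
      (E := fun x : M ↦ TangentSpace 𝓘(ℝ, E) x →L[ℝ] TangentSpace 𝓘(ℝ, E) x →L[ℝ] ℝ) x (val x))

namespace LorentzMetric

variable (g : LorentzMetric E M)

/-- The function `g(X, Y)`. -/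
def pair (X Y : VField E M) (x : M) : ℝ := g.val x (X x) (Y x)

theorem pair_symm (X Y : VField E M) : g.pair X Y = g.pair Y X :=
  funext fun x ↦ g.symm x _ _

theorem mdifferentiableAt_pair {X Y : VField E M} {x : M}
    (hX : MDiffAt (T% X) x) (hY : MDiffAt (T% Y) x) : MDiffAt (g.pair X Y) x := by
  have hg := g.contMDiff.mdifferentiableAt (x := x) (by simp)
  have := MDifferentiableAt.clm_bundle_apply₂ (F₁ := E)
    (F₂ := E) (F₃ := ℝ) (E₃ := Bundle.Trivial M ℝ) hg hX hY
  exact ((mdifferentiableAt_totalSpace _ _).1 this).2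

theorem eq_zero_of_forall (x : M) (v : TangentSpace 𝓘(ℝ, E) x) (h : ∀ w, g.val x v w = 0) :
    v = 0 := by
  obtain ⟨u, hu, hpos⟩ := g.signature x
  by_contra hv
  have h1 := hpos v (by rw [g.symm]; exact h u) hv
  rw [h v] at h1
  exact lt_irrefl _ h1

/-- The metric at a point as a bilinear form. -/
def bilin (x : M) : LinearMap.BilinForm ℝ (TangentSpace 𝓘(ℝ, E) x) :=
  LinearMap.mk₂ ℝ (fun v w ↦ g.val x v w) (by simp) (by simp) (by simp) (by simp)

theorem bilin_apply (x : M) (v w : TangentSpace 𝓘(ℝ, E) x) : g.bilin x v w = g.val x v w := rfl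

theorem bilin_nondegenerate (x : M) : (g.bilin x).Nondegenerate :=
  ⟨fun v h ↦ g.eq_zero_of_forall x v h,
    fun v h ↦ g.eq_zero_of_forall x v fun w ↦ (g.symm x v w).trans (h w)⟩

/-- The directional derivative `X(f)` of a function along a vector field. -/
def dirDeriv (X : VField E M) (f : M → ℝ) (x : M) : ℝ := mvfderiv 𝓘(ℝ, E) f x (X x)

/-- The right-hand side of the Koszul formula for `g(∇_X Y, Z)`. -/
def koszul (X Y Z : VField E M) (x : M) : ℝ :=
  (dirDeriv X (g.pair Y Z) x + dirDeriv Y (g.pair X Z) x - dirDeriv Z (g.pair X Y) x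
    + g.val x (VectorField.mlieBracket 𝓘(ℝ, E) X Y x) (Z x)
    - g.val x (VectorField.mlieBracket 𝓘(ℝ, E) X Z x) (Y x)
    - g.val x (VectorField.mlieBracket 𝓘(ℝ, E) Y Z x) (X x)) / 2

theorem pair_smul_left (f : M → ℝ) (X Y : VField E M) :
    g.pair (f • X) Y = f * g.pair X Y := by
  funext x; simp [pair]

theorem pair_smul_right (f : M → ℝ) (X Y : VField E M) :
    g.pair X (f • Y) = f * g.pair X Y := by
  funext x; simp [pair]

theorem pair_add_left (X X' Y : VField E M) :
    g.pair (X + X') Y = g.pair X Y + g.pair X' Y := by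
  funext x; simp [pair]

theorem pair_add_right (X Y Y' : VField E M) :
    g.pair X (Y + Y') = g.pair X Y + g.pair X Y' := by
  funext x; simp [pair]

variable [FiniteDimensional ℝ E]

theorem koszul_add_left {X X' Y Z : VField E M} {x : M} (hX : MDiffAt (T% X) x)
    (hX' : MDiffAt (T% X') x) (hY : MDiffAt (T% Y) x) (hZ : MDiffAt (T% Z) x) :
    g.koszul (X + X') Y Z x = g.koszul X Y Z x + g.koszul X' Y Z x := by
  have := FiniteDimensional.complete ℝ E
  simp only [koszul, dirDeriv, pair_add_left,
    mvfderiv_add (g.mdifferentiableAt_pair hX hY) (g.mdifferentiableAt_pair hX' hY),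
    mvfderiv_add (g.mdifferentiableAt_pair hX hZ) (g.mdifferentiableAt_pair hX' hZ),
    VectorField.mlieBracket_add_left hX hX', Pi.add_apply, map_add, add_apply]
  ring

theorem koszul_add_right {X Y Z Z' : VField E M} {x : M} (hX : MDiffAt (T% X) x)
    (hY : MDiffAt (T% Y) x) (hZ : MDiffAt (T% Z) x) (hZ' : MDiffAt (T% Z') x) :
    g.koszul X Y (Z + Z') x = g.koszul X Y Z x + g.koszul X Y Z' x := by
  have := FiniteDimensional.complete ℝ E
  simp only [koszul, dirDeriv, pair_add_right,
    mvfderiv_add (g.mdifferentiableAt_pair hX hZ) (g.mdifferentiableAt_pair hX hZ'),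
    mvfderiv_add (g.mdifferentiableAt_pair hY hZ) (g.mdifferentiableAt_pair hY hZ'),
    VectorField.mlieBracket_add_right hZ hZ', Pi.add_apply, map_add, add_apply]
  ring

theorem koszul_add_mid {X Y Y' Z : VField E M} {x : M} (hX : MDiffAt (T% X) x)
    (hY : MDiffAt (T% Y) x) (hY' : MDiffAt (T% Y') x) (hZ : MDiffAt (T% Z) x) :
    g.koszul X (Y + Y') Z x = g.koszul X Y Z x + g.koszul X Y' Z x := by
  have := FiniteDimensional.complete ℝ E
  simp only [koszul, dirDeriv, pair_add_left, pair_add_right,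
    mvfderiv_add (g.mdifferentiableAt_pair hX hY) (g.mdifferentiableAt_pair hX hY'),
    mvfderiv_add (g.mdifferentiableAt_pair hY hZ) (g.mdifferentiableAt_pair hY' hZ),
    VectorField.mlieBracket_add_left hY hY', VectorField.mlieBracket_add_right hY hY',
    Pi.add_apply, map_add, add_apply]
  ring

theorem koszul_smul_left {f : M → ℝ} {X Y Z : VField E M} {x : M} (hf : MDiffAt f x)
    (hX : MDiffAt (T% X) x) (hY : MDiffAt (T% Y) x) (hZ : MDiffAt (T% Z) x) :
    g.koszul (f • X) Y Z x = f x * g.koszul X Y Z x := by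
  have := FiniteDimensional.complete ℝ E
  simp only [koszul, dirDeriv, pair_smul_left,
    mvfderiv_mul hf (g.mdifferentiableAt_pair hX hY),
    mvfderiv_mul hf (g.mdifferentiableAt_pair hX hZ),
    VectorField.mlieBracket_smul_left hf hX, Pi.smul_apply', map_add, map_smul, map_neg,
    add_apply, smul_apply, smul_eq_mul, neg_smul,
    neg_apply]
  simp only [pair]
  ring

theorem koszul_smul_right {f : M → ℝ} {X Y Z : VField E M} {x : M} (hf : MDiffAt f x)
    (hX : MDiffAt (T% X) x) (hY : MDiffAt (T% Y) x) (hZ : MDiffAt (T% Z) x) :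
    g.koszul X Y (f • Z) x = f x * g.koszul X Y Z x := by
  have := FiniteDimensional.complete ℝ E
  simp only [koszul, dirDeriv, pair_smul_right,
    mvfderiv_mul hf (g.mdifferentiableAt_pair hX hZ),
    mvfderiv_mul hf (g.mdifferentiableAt_pair hY hZ),
    VectorField.mlieBracket_smul_right hf hZ, Pi.smul_apply', map_add, map_smul,
    add_apply, smul_apply, smul_eq_mul]
  simp only [pair, g.symm x (Z x)]
  ring

theorem koszul_smul_mid {f : M → ℝ} {X Y Z : VField E M} {x : M} (hf : MDiffAt f x)
    (hX : MDiffAt (T% X) x) (hY : MDiffAt (T% Y) x) (hZ : MDiffAt (T% Z) x) :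
    g.koszul X (f • Y) Z x = f x * g.koszul X Y Z x + dirDeriv X f x * g.pair Y Z x := by
  have := FiniteDimensional.complete ℝ E
  simp only [koszul, dirDeriv, pair_smul_right, pair_smul_left,
    mvfderiv_mul hf (g.mdifferentiableAt_pair hX hY),
    mvfderiv_mul hf (g.mdifferentiableAt_pair hY hZ),
    VectorField.mlieBracket_smul_right hf hY, VectorField.mlieBracket_smul_left hf hY,
    Pi.smul_apply', map_add, map_smul, map_neg, neg_smul,
    neg_apply,
    add_apply, smul_apply, smul_eq_mul]
  simp only [pair, g.symm x (Y x)]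
  ring

/-- The Koszul formula as a bilinear form in the values of `X` and `Z` at `x`. -/
def koszulHom (Y : VField E M) (x : M) (hY : MDiffAt (T% Y) x) :
    TangentSpace 𝓘(ℝ, E) x →L[ℝ] TangentSpace 𝓘(ℝ, E) x →L[ℝ] ℝ :=
  TensorialAt.mkHom₂ (I := 𝓘(ℝ, E)) (F := E) (F' := E) (fun X Z : VField E M ↦ g.koszul X Y Z x) x
    (fun _ hZ ↦ ⟨fun hf hX ↦ g.koszul_smul_left hf hX hY hZ,
      fun hX hX' ↦ g.koszul_add_left hX hX' hY hZ⟩)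
    (fun _ hX ↦ ⟨fun hf hZ ↦ g.koszul_smul_right hf hX hY hZ,
      fun hZ hZ' ↦ g.koszul_add_right hX hY hZ hZ'⟩)

theorem koszulHom_apply {X Y Z : VField E M} {x : M} (hX : MDiffAt (T% X) x)
    (hY : MDiffAt (T% Y) x) (hZ : MDiffAt (T% Z) x) :
    g.koszulHom Y x hY (X x) (Z x) = g.koszul X Y Z x :=
  TensorialAt.mkHom₂_apply _ _ hX hZ

instance tangentSpace_finite (x : M) : FiniteDimensional ℝ (TangentSpace 𝓘(ℝ, E) x) :=
  inferInstanceAs (FiniteDimensional ℝ E)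

instance tangentSpace_t2 (x : M) : T2Space (TangentSpace 𝓘(ℝ, E) x) :=
  inferInstanceAs (T2Space E)

/-- Raising an index: the vector `g`-dual to a covector. -/
def sharp (x : M) : (TangentSpace 𝓘(ℝ, E) x →L[ℝ] ℝ) →ₗ[ℝ] TangentSpace 𝓘(ℝ, E) x :=
  ((g.bilin x).toDual (g.bilin_nondegenerate x)).symm.toLinearMap ∘ₗ
    ContinuousLinearMap.coeLM ℝ

theorem val_sharp (x : M) (f : TangentSpace 𝓘(ℝ, E) x →L[ℝ] ℝ) (w : TangentSpace 𝓘(ℝ, E) x) :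
    g.val x (g.sharp x f) w = f w :=
  LinearMap.BilinForm.apply_toDual_symm_apply (hB := g.bilin_nondegenerate x) _ _

open Classical in
/-- The map `v ↦ ∇_v Y` at `x`, obtained from the Koszul formula. -/
def leviCivitaFun (Y : VField E M) (x : M) :
    TangentSpace 𝓘(ℝ, E) x →L[ℝ] TangentSpace 𝓘(ℝ, E) x :=
  if hY : MDiffAt (T% Y) x then
    LinearMap.toContinuousLinearMap (g.sharp x ∘ₗ (g.koszulHom Y x hY).toLinearMap)
  else 0

theorem val_leviCivitaFun {X Y Z : VField E M} {x : M} (hX : MDiffAt (T% X) x)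
    (hY : MDiffAt (T% Y) x) (hZ : MDiffAt (T% Z) x) :
    g.val x (g.leviCivitaFun Y x (X x)) (Z x) = g.koszul X Y Z x := by
  rw [← g.koszulHom_apply hX hY hZ, leviCivitaFun, dif_pos hY]
  exact g.val_sharp x _ _

theorem ext_of_extend {x : M} {A B : TangentSpace 𝓘(ℝ, E) x →L[ℝ] TangentSpace 𝓘(ℝ, E) x}
    (h : ∀ X Z : VField E M, MDiffAt (T% X) x → MDiffAt (T% Z) x →
      g.val x (A (X x)) (Z x) = g.val x (B (X x)) (Z x)) : A = B := by
  ext v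
  rw [← sub_eq_zero]
  refine g.eq_zero_of_forall x _ fun w ↦ ?_
  have := h (FiberBundle.extend E v) (FiberBundle.extend E w)
    (FiberBundle.mdifferentiableAt_extend ..) (FiberBundle.mdifferentiableAt_extend ..)
  simp only [FiberBundle.extend_apply_self] at this
  simp [this]

/-- The Levi-Civita connection of `g`; `g.leviCivita Y x v` is `∇_v Y` at `x`. -/
def leviCivita : CovariantDerivative 𝓘(ℝ, E) E (TangentSpace 𝓘(ℝ, E) : M → Type _) where
  toFun := g.leviCivitaFun
  isCovariantDerivativeOnUniv :=
    { add := by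
        intro Y Y' x hY hY' _
        refine g.ext_of_extend fun X Z hX hZ ↦ ?_
        rw [g.val_leviCivitaFun hX (mdifferentiableAt_add_section hY hY') hZ,
          add_apply, map_add, add_apply, g.val_leviCivitaFun hX hY hZ,
          g.val_leviCivitaFun hX hY' hZ, g.koszul_add_mid hX hY hY' hZ]
      leibniz := by
        intro Y f x hY hf _
        refine g.ext_of_extend fun X Z hX hZ ↦ ?_
        rw [g.val_leviCivitaFun hX (hf.smul_section hY) hZ, g.koszul_smul_mid hf hX hY hZ]
        simp [g.val_leviCivitaFun hX hY hZ, dirDeriv, pair] }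

/-- The field `∇_X Y`. -/
def cov (X Y : VField E M) : VField E M := fun x ↦ g.leviCivita Y x (X x)

theorem val_cov {X Y Z : VField E M} {x : M} (hX : MDiffAt (T% X) x)
    (hY : MDiffAt (T% Y) x) (hZ : MDiffAt (T% Z) x) :
    g.val x (g.cov X Y x) (Z x) = g.koszul X Y Z x :=
  g.val_leviCivitaFun hX hY hZ

theorem leviCivita_torsionFree {X Y : VField E M} {x : M} (hX : MDiffAt (T% X) x)
    (hY : MDiffAt (T% Y) x) :
    g.cov X Y x - g.cov Y X x = VectorField.mlieBracket 𝓘(ℝ, E) X Y x := by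
  rw [← sub_eq_zero]
  refine g.eq_zero_of_forall x _ fun w ↦ ?_
  have hw := FiberBundle.mdifferentiableAt_extend 𝓘(ℝ, E) E w
  have h1 := g.val_cov hX hY hw
  have h2 := g.val_cov hY hX hw
  simp only [FiberBundle.extend_apply_self] at h1 h2
  rw [map_sub, map_sub, sub_apply, sub_apply, h1, h2, koszul, koszul, g.pair_symm Y X,
    VectorField.mlieBracket_swap_apply (V := Y) (W := X)]
  simp only [map_neg, neg_apply, FiberBundle.extend_apply_self]
  ring

theorem leviCivita_metric {X Y Z : VField E M} {x : M} (hX : MDiffAt (T% X) x)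
    (hY : MDiffAt (T% Y) x) (hZ : MDiffAt (T% Z) x) :
    dirDeriv X (g.pair Y Z) x = g.val x (g.cov X Y x) (Z x) + g.val x (Y x) (g.cov X Z x) := by
  rw [g.symm x (Y x), g.val_cov hX hY hZ, g.val_cov hX hZ hY, koszul, koszul, g.pair_symm Z Y,
    VectorField.mlieBracket_swap_apply (V := Z) (W := Y)]
  simp only [map_neg, neg_apply]
  ring

/-- The second covariant derivative: `g(∇²_{Y,Z} v, A) = v_{a;bc} A^a Y^b Z^c`. -/
def cov2 (v Y Z : VField E M) : VField E M :=
  g.cov Z (g.cov Y v) - g.cov (g.cov Z Y) v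

/-- The curvature `R(X, Y) Z = ∇_X ∇_Y Z - ∇_Y ∇_X Z - ∇_{[X, Y]} Z`. -/
def curv (X Y Z : VField E M) : VField E M :=
  g.cov X (g.cov Y Z) - g.cov Y (g.cov X Z) - g.cov (VectorField.mlieBracket 𝓘(ℝ, E) X Y) Z

/-- The fully covariant Riemann tensor
`R_{sabc} S^s A^a B^b C^c = g(R(C, B) S, A)`, the sign convention being that of the Ricci
identities `v_{a;bc} - v_{a;cb} = R_{sabc} v^s`. -/
def riem (S A B C : VField E M) (x : M) : ℝ := g.val x (g.curv C B S x) (A x)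

end LorentzMetric

/-- Frame indices: `0`, `1` and the transverse ones (`i = 2, …, n - 1` in the usual numbering). -/
abbrev FIdx (n : ℕ) : Type := Fin 2 ⊕ Fin (n - 2)

/-- The frame index `0`: contraction with `ℓ`. -/
abbrev i0 {n : ℕ} : FIdx n := Sum.inl 0

/-- The frame index `1`: contraction with `n`. -/
abbrev i1 {n : ℕ} : FIdx n := Sum.inl 1

instance (n : ℕ) : Coe (Fin (n - 2)) (FIdx n) := ⟨Sum.inr⟩

/-- The components of the metric in a null frame: `g_{01} = g_{10} = 1`, `g_{ij} = δ_{ij}`, all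
others zero. This matrix is its own inverse, so these are also the components `g^{ab}`. -/
def eta (n : ℕ) : FIdx n → FIdx n → ℝ
  | Sum.inl a, Sum.inl b => if a = b then 0 else 1
  | Sum.inr i, Sum.inr j => if i = j then 1 else 0
  | _, _ => 0

/-- Kronecker's delta for transverse indices. -/
def kron {n : ℕ} (i j : Fin (n - 2)) : ℝ := if i = j then 1 else 0

/-- Antisymmetrization `T_{[ab]} = (T_{ab} - T_{ba}) / 2`. -/
def asym {ι : Type*} (T : ι → ι → ℝ) (a b : ι) : ℝ := (T a b - T b a) / 2

section Components

variable {n : ℕ} (R : FIdx n → FIdx n → FIdx n → FIdx n → ℝ)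

/-- Frame components of the Ricci tensor, `R_{ab} = g^{cd} R_{cadb}`. -/
def ricci (a b : FIdx n) : ℝ := ∑ c, ∑ d, eta n c d * R c a d b

/-- The scalar curvature `g^{ab} R_{ab}`. -/
def scal : ℝ := ∑ a, ∑ b, eta n a b * ricci R a b

/-- Frame components of the Weyl tensor. -/
def weyl (a b c d : FIdx n) : ℝ :=
  R a b c d
    - 1 / ((n : ℝ) - 2) * (eta n a c * ricci R b d - eta n a d * ricci R b c
        - eta n b c * ricci R a d + eta n b d * ricci R a c)
    + 1 / (((n : ℝ) - 1) * ((n : ℝ) - 2)) * scal R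
        * (eta n a c * eta n b d - eta n a d * eta n b c)

/-- The algebraic symmetries of a Riemann tensor. -/
structure IsCurvatureLike : Prop where
  antisymm_left : ∀ a b c d, R b a c d = -R a b c d
  antisymm_right : ∀ a b c d, R a b d c = -R a b c d
  bianchi : ∀ a b c d, R a b c d + R a c d b + R a d b c = 0

end Components

/-- The system of frame Ricci identities at a point `x`, for frame derivatives `D`, `Δ`, `δ i`,
rotation coefficients `L`, `N`, `M`, frame components `C` and `Ric` of the Weyl and Ricci tensors
and scalar curvature `S`. Sums over repeated transverse indices are written out; the name of a
field records the contraction (`L`, `N`, `M` for the identity of `ℓ`, `n`, `m^(i)`, followed by the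
three contracting vectors). -/
structure RicciSystem {n : ℕ} {X : Type*} (D Δ : (X → ℝ) → X → ℝ)
    (δ : Fin (n - 2) → (X → ℝ) → X → ℝ) (L N : FIdx n → FIdx n → X → ℝ)
    (M : Fin (n - 2) → FIdx n → FIdx n → X → ℝ)
    (C : FIdx n → FIdx n → FIdx n → FIdx n → ℝ) (Ric : FIdx n → FIdx n → ℝ) (S : ℝ)
    (x : X) : Prop where
  L_n_ell_n :
    D (L i1 i1) x - Δ (L i1 i0) x =
      -2 * L i1 i0 x * L i1 i1 x - ∑ i : Fin (n - 2), L i1 i x * L i i1 x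
        + ∑ i : Fin (n - 2), N i i0 x * (L i1 i x + L i i1 x)
        - ∑ i : Fin (n - 2), L i i0 x * N i i1 x
        - C i0 i1 i0 i1 + 2 / ((n : ℝ) - 2) * Ric i0 i1
        - 1 / (((n : ℝ) - 1) * ((n : ℝ) - 2)) * S
  L_n_ell_m : ∀ i : Fin (n - 2),
    D (L i1 i) x - δ i (L i1 i0) x =
      -L i1 i1 x * L i i0 x - L i1 i0 x * (L i1 i x + N i i0 x)
        + 2 * ∑ j : Fin (n - 2), asym (fun a b ↦ L j a x * N j b x) i i0
        - ∑ j : Fin (n - 2), L i1 j x * (L j i x + M j i i0 x)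
        - C i0 i1 i0 i + 1 / ((n : ℝ) - 2) * Ric i0 i
  N_ell_n_m : ∀ i : Fin (n - 2),
    Δ (L i1 i) x - δ i (L i1 i1) x =
      -L i1 i0 x * N i i1 x + L i1 i1 x * (L i1 i x - L i i1 x)
        - 2 * ∑ j : Fin (n - 2), asym (fun a b ↦ L j a x * N j b x) i1 i
        - ∑ j : Fin (n - 2), L i1 j x * (N j i x + M j i i1 x)
        + C i1 i0 i1 i - 1 / ((n : ℝ) - 2) * Ric i1 i
  L_n_m_m : ∀ i j : Fin (n - 2),
    asym (fun a b : Fin (n - 2) ↦ δ a (L i1 b) x) j i =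
      -L i1 i1 x * asym (fun a b : Fin (n - 2) ↦ L a b x) i j
        - L i1 i0 x * asym (fun a b : Fin (n - 2) ↦ N a b x) i j
        - ∑ k : Fin (n - 2), L i1 k x * asym (fun a b : Fin (n - 2) ↦ M k a b x) i j
        - ∑ k : Fin (n - 2), asym (fun a b : Fin (n - 2) ↦ L k a x * N k b x) j i
        + 1 / 2 * C i0 i1 i j
  L_m_ell_n : ∀ i : Fin (n - 2),
    D (L i i1) x - Δ (L i i0) x =
      -2 * L i1 i1 x * L i i0 x + ∑ j : Fin (n - 2), L i j x * (-L j i1 x + N j i0 x)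
        + 2 * ∑ j : Fin (n - 2), asym (fun a b ↦ L j a x * M j i b x) i0 i1
        - C i0 i1 i0 i + 1 / ((n : ℝ) - 2) * Ric i0 i
  N_m_n_ell : ∀ i : Fin (n - 2),
    Δ (N i i0) x - D (N i i1) x =
      2 * L i1 i0 x * N i i1 x + ∑ j : Fin (n - 2), N i j x * (-N j i0 x + L j i1 x)
        + 2 * ∑ j : Fin (n - 2), asym (fun a b ↦ N j a x * M j i b x) i1 i0
        - C i1 i0 i1 i + 1 / ((n : ℝ) - 2) * Ric i1 i
  L_m_ell_m : ∀ i j : Fin (n - 2),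
    D (L i j) x - δ j (L i i0) x =
      L i1 i0 x * L i j x - L i i0 x * (2 * L i1 j x + N j i0 x) - L i i1 x * L j i0 x
        + 2 * ∑ k : Fin (n - 2), asym (fun a b ↦ L k a x * M k i b x) i0 j
        - ∑ k : Fin (n - 2), L i k x * (L k j x + M k j i0 x)
        - C i0 i i0 j - 1 / ((n : ℝ) - 2) * Ric i0 i0 * kron i j
  N_m_n_m : ∀ i j : Fin (n - 2),
    Δ (N i j) x - δ j (N i i1) x =
      -L i1 i1 x * N i j x - N i i1 x * (-2 * L i1 j x + L j i1 x) - N i i0 x * N j i1 x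
        + 2 * ∑ k : Fin (n - 2), asym (fun a b ↦ N k a x * M k i b x) i1 j
        - ∑ k : Fin (n - 2), N i k x * (N k j x + M k j i1 x)
        - C i1 i i1 j - 1 / ((n : ℝ) - 2) * Ric i1 i1 * kron i j
  L_m_n_m : ∀ i j : Fin (n - 2),
    Δ (L i j) x - δ j (L i i1) x =
      L i1 i1 x * L i j x - L i i1 x * L j i1 x - L i i0 x * N j i1 x
        + 2 * ∑ k : Fin (n - 2), asym (fun a b ↦ L k a x * M k i b x) i1 j
        - ∑ k : Fin (n - 2), L i k x * (N k j x + M k j i1 x)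
        - C i0 i i1 j - 1 / ((n : ℝ) - 2) * (Ric i j + Ric i0 i1 * kron i j)
        + 1 / (((n : ℝ) - 1) * ((n : ℝ) - 2)) * S * kron i j
  N_m_ell_m : ∀ i j : Fin (n - 2),
    D (N i j) x - δ j (N i i0) x =
      -L i1 i0 x * N i j x - N i i0 x * N j i0 x - N i i1 x * L j i0 x
        + 2 * ∑ k : Fin (n - 2), asym (fun a b ↦ N k a x * M k i b x) i0 j
        - ∑ k : Fin (n - 2), N i k x * (L k j x + M k j i0 x)
        - C i0 j i1 i - 1 / ((n : ℝ) - 2) * (Ric i j + Ric i0 i1 * kron i j)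
        + 1 / (((n : ℝ) - 1) * ((n : ℝ) - 2)) * S * kron i j
  L_m_m_m : ∀ i j k : Fin (n - 2),
    asym (fun a b : Fin (n - 2) ↦ δ a (L i b) x) j k =
      asym (fun a b : Fin (n - 2) ↦ L i1 a x * L i b x) j k
        + L i i1 x * asym (fun a b : Fin (n - 2) ↦ L a b x) j k
        + L i i0 x * asym (fun a b : Fin (n - 2) ↦ N a b x) j k
        + ∑ l : Fin (n - 2), L i l x * asym (fun a b : Fin (n - 2) ↦ M l a b x) j k
        + ∑ l : Fin (n - 2), asym (fun a b : Fin (n - 2) ↦ L l a x * M l i b x) j k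
        - 1 / 2 * C i0 i j k
        - 1 / ((n : ℝ) - 2) * asym (fun a b : Fin (n - 2) ↦ Ric i0 a * kron b i) j k
  N_m_m_m : ∀ i j k : Fin (n - 2),
    asym (fun a b : Fin (n - 2) ↦ δ a (N i b) x) j k =
      -asym (fun a b : Fin (n - 2) ↦ L i1 a x * N i b x) j k
        + N i i0 x * asym (fun a b : Fin (n - 2) ↦ N a b x) j k
        + N i i1 x * asym (fun a b : Fin (n - 2) ↦ L a b x) j k
        + ∑ l : Fin (n - 2), N i l x * asym (fun a b : Fin (n - 2) ↦ M l a b x) j k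
        + ∑ l : Fin (n - 2), asym (fun a b : Fin (n - 2) ↦ N l a x * M l i b x) j k
        - 1 / 2 * C i1 i j k
        - 1 / ((n : ℝ) - 2) * asym (fun a b : Fin (n - 2) ↦ Ric i1 a * kron b i) j k
  M_m_ell_n : ∀ i j : Fin (n - 2),
    D (M i j i1) x - Δ (M i j i0) x =
      2 * asym (fun a b ↦ N i a x * L j b x) i1 i0
        + 2 * asym (fun a b ↦ L i a x * N j b x) i1 i0
        - L i1 i0 x * M i j i1 x - L i1 i1 x * M i j i0 x
        + 2 * ∑ k : Fin (n - 2), asym (fun a b ↦ M i k a x * M k j b x) i0 i1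
        + ∑ k : Fin (n - 2), M i j k x * (-L k i1 x + N k i0 x)
        - C i0 i1 i j
  M_m_ell_m : ∀ i j k : Fin (n - 2),
    D (M i j k) x - δ k (M i j i0) x =
      2 * asym (fun a b ↦ L j a x * N i b x) i0 k
        + 2 * asym (fun a b ↦ N j a x * L i b x) i0 k
        - L k i0 x * M i j i1 x - M i j i0 x * (L i1 k x + N k i0 x)
        + 2 * ∑ l : Fin (n - 2), asym (fun a b ↦ M i l a x * M l j b x) i0 k
        - ∑ l : Fin (n - 2), M i j l x * (L l k x + M l k i0 x)
        - C i0 k i j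
        - 2 / ((n : ℝ) - 2) * asym (fun a b : Fin (n - 2) ↦ Ric i0 a * kron b k) i j
  M_m_n_m : ∀ i j k : Fin (n - 2),
    Δ (M i j k) x - δ k (M i j i1) x =
      2 * asym (fun a b ↦ N j a x * L i b x) i1 k
        + 2 * asym (fun a b ↦ L j a x * N i b x) i1 k
        - N k i1 x * M i j i0 x + M i j i1 x * (L i1 k x - L k i1 x)
        + 2 * ∑ l : Fin (n - 2), asym (fun a b ↦ M i l a x * M l j b x) i1 k
        - ∑ l : Fin (n - 2), M i j l x * (N l k x + M l k i1 x)
        - C i1 k i j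
        - 2 / ((n : ℝ) - 2) * asym (fun a b : Fin (n - 2) ↦ Ric i1 a * kron b k) i j
  M_m_m_m : ∀ i j k l : Fin (n - 2),
    asym (fun a b : Fin (n - 2) ↦ δ a (M i j b) x) k l =
      asym (fun a b : Fin (n - 2) ↦ N i a x * L j b x) l k
        + asym (fun a b : Fin (n - 2) ↦ L i a x * N j b x) l k
        + asym (fun a b : Fin (n - 2) ↦ L a b x) k l * M i j i1 x
        + asym (fun a b : Fin (n - 2) ↦ N a b x) k l * M i j i0 x
        + ∑ p : Fin (n - 2), asym (fun a b : Fin (n - 2) ↦ M i p a x * M p j b x) k l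
        + ∑ p : Fin (n - 2), M i j p x * asym (fun a b : Fin (n - 2) ↦ M p a b x) k l
        - 1 / 2 * C i j k l
        - 1 / ((n : ℝ) - 2) * (asym (fun a b : Fin (n - 2) ↦ kron i a * Ric b j) k l
            - asym (fun a b : Fin (n - 2) ↦ kron j a * Ric b i) k l)
        + 1 / (((n : ℝ) - 1) * ((n : ℝ) - 2)) * S
            * asym (fun a b : Fin (n - 2) ↦ kron i a * kron j b) k l

/-- A smooth null frame `(ℓ, n, m^(i))` on the set `U`. -/
structure NullFrame (g : LorentzMetric E M) (n : ℕ) (U : Set M) where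
  /-- the null vector `ℓ` -/
  ell : VField E M
  /-- the null vector `n` -/
  nn : VField E M
  /-- the spacelike vectors `m^(i)` -/
  mm : Fin (n - 2) → VField E M
  smooth_ell : CMDiff[U] ∞ (T% ell)
  smooth_nn : CMDiff[U] ∞ (T% nn)
  smooth_mm : ∀ i, CMDiff[U] ∞ (T% (mm i))
  ell_ell : ∀ x ∈ U, g.pair ell ell x = 0
  nn_nn : ∀ x ∈ U, g.pair nn nn x = 0
  ell_nn : ∀ x ∈ U, g.pair ell nn x = 1
  ell_mm : ∀ i, ∀ x ∈ U, g.pair ell (mm i) x = 0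
  nn_mm : ∀ i, ∀ x ∈ U, g.pair nn (mm i) x = 0
  mm_mm : ∀ i j, ∀ x ∈ U, g.pair (mm i) (mm j) x = kron i j

namespace NullFrame

variable {g : LorentzMetric E M} {n : ℕ} {U : Set M} (F : NullFrame g n U)

/-- The frame as a family: `T_{…a…}` is the contraction of `T` with `F.e a`, so that
`F.e 0 = ℓ`, `F.e 1 = n`, `F.e i = m^(i)`. -/
def e : FIdx n → VField E M := Sum.elim ![F.ell, F.nn] F.mm

variable [FiniteDimensional ℝ E]

/-- The frame components `V_{a;b}` of the covariant derivative of a vector field `V`. -/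
def comp (V : VField E M) (a b : FIdx n) (x : M) : ℝ := g.val x (g.cov (F.e b) V x) (F.e a x)

/-- The rotation coefficients `L_{ab}`: the frame components of `ℓ_{a;b}`. -/
def rotL : FIdx n → FIdx n → M → ℝ := F.comp F.ell

/-- The rotation coefficients `N_{ab}`: the frame components of `n_{a;b}`. -/
def rotN : FIdx n → FIdx n → M → ℝ := F.comp F.nn

/-- The rotation coefficients `M^i_{ab}`: the frame components of `m^(i)_{a;b}`. -/
def rotM (i : Fin (n - 2)) : FIdx n → FIdx n → M → ℝ := F.comp (F.mm i)

/-- The frame components `R_{sabc}` of the Riemann tensor at `x`. -/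
def R (x : M) (s a b c : FIdx n) : ℝ := g.riem (F.e s) (F.e a) (F.e b) (F.e c) x

/-- The frame Ricci identities at `x`, for the rotation coefficients of the frame, the derivatives
`D`, `Δ`, `δ_i` along `ℓ`, `n`, `m^(i)`, and the Weyl, Ricci and scalar parts of a given array `ρ` of
curvature components. -/
def ricciSystem (ρ : FIdx n → FIdx n → FIdx n → FIdx n → ℝ) (x : M) : Prop :=
  RicciSystem (LorentzMetric.dirDeriv F.ell) (LorentzMetric.dirDeriv F.nn)
    (fun i ↦ LorentzMetric.dirDeriv (F.mm i)) F.rotL F.rotN F.rotM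
    (weyl ρ) (ricci ρ) (scal ρ) x

/-- The frame components `v_{a;bc} - v_{a;cb}` for the frame vector `v = e_s`. -/
def comm2 (x : M) (s a b c : FIdx n) : ℝ :=
  g.val x (g.cov2 (F.e s) (F.e b) (F.e c) x - g.cov2 (F.e s) (F.e c) (F.e b) x) (F.e a x)

end NullFrame

end HDNP

end

namespace HDNP

/-! ### Algebra of null-frame components and curvature-like arrays -/

section FrameAlgebra

variable {n : ℕ}

/-! Write Γ_{sab} for the frame components of (e_s)_{a;b}, so that L, N, M are the values s = 0, 1,
i. Since the products g(e_s, e_a) are constant, Γ_{sab} = -Γ_{asb}. Hence L_{0b} = N_{1b} = 0,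
N_{0b} = -L_{1b}, M^i_{0b} = -L_{ib}, M^i_{1b} = -N_{ib}, and only L_{1b}, L_{ib}, N_{ib}, M^i_{jb}
need appear.

Expanding the second covariant derivatives of e_s in the frame turns v_{a;bc} - v_{a;cb} into
`frameCurv`: two frame derivatives of Γ plus quadratic terms (`comm2_eq_frameCurv`). This array is
antisymmetric in (b, c) by its form and in (s, a) because Γ is.

An array antisymmetric in each of its two pairs is determined by the pairs 01, 0i, 1i, ij in both
places: 4 × 4 = 16 blocks. The sixteen equations are these blocks, with ρ rewritten through its
Weyl, Ricci and scalar parts. The rewriting is an identity for every curvature-like ρ, so each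
equation is equivalent to its block. This gives completeness, and the equations themselves are the
case where ρ is the Riemann tensor.

For that case two facts about the Levi-Civita connection are needed. Vanishing torsion identifies
v_{a;bc} - v_{a;cb} with the curvature operator (`cov2_sub_cov2`). Vanishing torsion and the Jacobi
identity give the first Bianchi identity (`curv_cyclic`). Smoothness of Γ comes from the Koszul
formula, which in such a frame involves only brackets of the frame fields (`comp_eq`). -/

theorem sum_eta (f : FIdx n → FIdx n → ℝ) :
    ∑ p, ∑ q, eta n p q * f p q = f i0 i1 + f i1 i0 + ∑ k : Fin (n - 2), f k k := by
  simp [Fintype.sum_sum_type, eta, Finset.sum_ite_eq]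

theorem sum_eta_mul_eta (a b : FIdx n) : ∑ p, eta n a p * eta n p b = if a = b then 1 else 0 := by
  rcases a with a | i <;> rcases b with b | j
  · fin_cases a <;> fin_cases b <;> simp [Fintype.sum_sum_type, eta]
  · simp [Fintype.sum_sum_type, eta]
  · simp [Fintype.sum_sum_type, eta]
  · simp [Fintype.sum_sum_type, eta]

theorem eta_comm (a b : FIdx n) : eta n a b = eta n b a := by
  rcases a with a | a <;> rcases b with b | b <;> simp [eta, eq_comm]

/-- An array with the symmetries of a Riemann tensor is symmetric under exchange of pairs. -/
theorem IsCurvatureLike.pair_symm {ρ : FIdx n → FIdx n → FIdx n → FIdx n → ℝ}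
    (h : IsCurvatureLike ρ) (a b c d : FIdx n) : ρ a b c d = ρ c d a b := by
  -- Put P = ρ_{abcd}, Q = ρ_{acdb}, T = ρ_{adbc}, a prime exchanging the pairs. Modulo antisymmetry
  -- and an overall sign, the four cyclic identities are P+Q+T = P+Q'+T' = P'+Q+T' = P'+Q'+T = 0.
  -- The first two minus the last two give 2P = 2P'.
  linarith [h.bianchi a b c d, h.bianchi b c d a, h.bianchi c d a b, h.bianchi d a b c,
    h.antisymm_left a b c d, h.antisymm_left b c d a, h.antisymm_left c d a b,
    h.antisymm_left d a b c, h.antisymm_right a b c d, h.antisymm_right b c d a,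
    h.antisymm_right c d a b, h.antisymm_right d a b c,
    h.antisymm_left a c b d, h.antisymm_right a c b d, h.antisymm_right c a b d,
    h.antisymm_left a d b c, h.antisymm_right a d b c, h.antisymm_right d a b c,
    h.antisymm_left b d c a, h.antisymm_right b d c a, h.antisymm_right d b c a,
    h.antisymm_left b d a c, h.antisymm_right b d a c, h.antisymm_right d b a c,
    h.antisymm_left c a d b, h.antisymm_right c a d b]

/-- Pair symmetry exchanges the two free indices and the two contracted ones; the symmetry of the
metric undoes the latter exchange. -/
theorem IsCurvatureLike.ricci_symm {ρ : FIdx n → FIdx n → FIdx n → FIdx n → ℝ}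
    (h : IsCurvatureLike ρ) (a b : FIdx n) : ricci ρ a b = ricci ρ b a := by
  rw [ricci, Finset.sum_comm]
  refine Finset.sum_congr rfl fun c _ ↦ Finset.sum_congr rfl fun d _ ↦ ?_
  rw [eta_comm, h.pair_symm]

/-- Antisymmetry kills the diagonal and supplies the reversed pairs. Applied to each pair of a
curvature array, this is what reduces all contractions to sixteen blocks. -/
theorem eq_of_antisymm {f g : FIdx n → FIdx n → ℝ} (hf : ∀ a b, f b a = -f a b)
    (hg : ∀ a b, g b a = -g a b) (h01 : f i0 i1 = g i0 i1)
    (h0 : ∀ i : Fin (n - 2), f i0 i = g i0 i) (h1 : ∀ i : Fin (n - 2), f i1 i = g i1 i)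
    (h : ∀ i j : Fin (n - 2), f i j = g i j) (a b : FIdx n) : f a b = g a b := by
  have key : ∀ {a b}, f a b = g a b → f b a = g b a := fun {a b} h ↦ by rw [hf, hg, h]
  have hd : ∀ a, f a a = g a a := fun a ↦ by linarith [hf a a, hg a a]
  rcases a with a | i <;> rcases b with b | j
  · fin_cases a <;> fin_cases b
    exacts [hd _, h01, key h01, hd _]
  · fin_cases a
    exacts [h0 j, h1 j]
  · fin_cases b
    exacts [key (h0 i), key (h1 i)]
  · exact h i j

/-! ### Second covariant derivatives through rotation coefficients -/

/-- The frame components `v_{a;bc} - v_{a;cb}` for `v = e_s` in terms of the rotation coefficients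
`Γ s a b = (e_s)_{a;b}` and the frame derivatives `d`. -/
noncomputable def frameCurv {X : Type*} (d : FIdx n → (X → ℝ) → X → ℝ)
    (Γ : FIdx n → FIdx n → FIdx n → X → ℝ) (x : X) (s a b c : FIdx n) : ℝ :=
  d c (Γ s a b) x - d b (Γ s a c) x
    + ∑ p, ∑ q, eta n p q * (Γ s p b x * Γ q a c x - Γ s p c x * Γ q a b x)
    + ∑ p, ∑ q, eta n p q * ((Γ p b c x - Γ p c b x) * Γ s a q x)

variable {X : Type*} {d : FIdx n → (X → ℝ) → X → ℝ} {Γ : FIdx n → FIdx n → FIdx n → X → ℝ} {x : X}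

theorem frameCurv_antisymm_right (s a b c : FIdx n) :
    frameCurv d Γ x s a c b = -frameCurv d Γ x s a b c := by
  simp only [frameCurv, sum_eta, Finset.sum_sub_distrib, sub_mul]
  ring

/-- In the quadratic part two sign changes cancel, and renaming the dummies p, q turns each product
into the other, which carries the opposite sign. Antisymmetry of the derivatives is a separate
hypothesis, since antisymmetry of Γ at the single point x does not imply it. -/
theorem frameCurv_antisymm_left (hΓ : ∀ s a b, Γ s a b x = -Γ a s b x)
    (hd : ∀ s a b c, d c (Γ s a b) x = -d c (Γ a s b) x) (s a b c : FIdx n) :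
    frameCurv d Γ x a s b c = -frameCurv d Γ x s a b c := by
  simp only [frameCurv]
  have h1 : ∑ p, ∑ q, eta n p q * (Γ a p b x * Γ q s c x - Γ a p c x * Γ q s b x)
      = -∑ p, ∑ q, eta n p q * (Γ s p b x * Γ q a c x - Γ s p c x * Γ q a b x) := by
    rw [Finset.sum_comm, ← Finset.sum_neg_distrib]
    refine Finset.sum_congr rfl fun q _ ↦ ?_
    rw [← Finset.sum_neg_distrib]
    refine Finset.sum_congr rfl fun p _ ↦ ?_
    rw [eta_comm p q, hΓ a p, hΓ q s, hΓ a p, hΓ q s]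
    ring
  have h2 : ∑ p, ∑ q, eta n p q * ((Γ p b c x - Γ p c b x) * Γ a s q x)
      = -∑ p, ∑ q, eta n p q * ((Γ p b c x - Γ p c b x) * Γ s a q x) := by
    simp only [hΓ a s, mul_neg, Finset.sum_neg_distrib]
  rw [h1, h2, hd a s, hd a s]
  ring

/-- The null metric pairs 0 with 1 and each transverse index with itself, so every contraction
becomes two explicit products and one transverse sum, the shape used in the frame equations. -/
theorem frameCurv_eq (s a b c : FIdx n) :
    frameCurv d Γ x s a b c = d c (Γ s a b) x - d b (Γ s a c) x
      + (Γ s i0 b x * Γ i1 a c x + Γ s i1 b x * Γ i0 a c x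
        + ∑ k : Fin (n - 2), Γ s k b x * Γ k a c x)
      - (Γ s i0 c x * Γ i1 a b x + Γ s i1 c x * Γ i0 a b x
        + ∑ k : Fin (n - 2), Γ s k c x * Γ k a b x)
      + ((Γ i0 b c x - Γ i0 c b x) * Γ s a i1 x + (Γ i1 b c x - Γ i1 c b x) * Γ s a i0 x
        + ∑ k : Fin (n - 2), Γ s a k x * Γ k b c x - ∑ k : Fin (n - 2), Γ s a k x * Γ k c b x) := by
  simp only [frameCurv, sum_eta, Finset.sum_sub_distrib, sub_mul, mul_comm (Γ s a _ x)]
  ring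

theorem eta_i0_i0 : eta n i0 i0 = 0 := by simp [eta]

theorem eta_i1_i1 : eta n i1 i1 = 0 := by simp [eta]

theorem eta_i0_i1 : eta n i0 i1 = 1 := by simp [eta]

theorem eta_i1_i0 : eta n i1 i0 = 1 := by simp [eta]

theorem eta_inl_inr (a : Fin 2) (i : Fin (n - 2)) : eta n (Sum.inl a) i = 0 := rfl

theorem eta_inr_inl (a : Fin 2) (i : Fin (n - 2)) : eta n i (Sum.inl a) = 0 := rfl

theorem eta_inr_inr (i j : Fin (n - 2)) : eta n i j = kron i j := rfl

theorem kron_comm (i j : Fin (n - 2)) : kron i j = kron j i := by simp [kron, eq_comm]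

/-! ### Equivalence of the sixteen equations with the frame identities -/

set_option linter.unusedSimpArgs false in
/-- The frame equations follow from the contracted Ricci identities. -/
theorem ricciSystem_of_frameCurv_eq (hΓ : ∀ s a b, Γ s a b x = -Γ a s b x)
    {ρ : FIdx n → FIdx n → FIdx n → FIdx n → ℝ} (hρ : IsCurvatureLike ρ)
    (H : ∀ s a b c, frameCurv d Γ x s a b c = ρ s a b c) :
    RicciSystem (d i0) (d i1) (fun i ↦ d i) (Γ i0) (Γ i1) (fun i ↦ Γ i)
      (weyl ρ) (ricci ρ) (scal ρ) x := by
  -- These four relations eliminate the dependent coefficients, leaving L_{1b}, L_{ib}, N_{ib},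
  -- M^i_{jb}.
  have h0 : ∀ s c, Γ s s c x = 0 := fun s c ↦ by linarith [hΓ s s c]
  have h10 : ∀ c, Γ i1 i0 c x = -Γ i0 i1 c x := fun c ↦ hΓ _ _ _
  have hi0 : ∀ (i : Fin (n - 2)) c, Γ i i0 c x = -Γ i0 i c x := fun i c ↦ hΓ _ _ _
  have hi1 : ∀ (i : Fin (n - 2)) c, Γ i i1 c x = -Γ i1 i c x := fun i c ↦ hΓ _ _ _
  have hR := hρ.ricci_symm
  have hR' : ∀ (i : Fin (n - 2)) (a : Fin 2), ricci ρ i (Sum.inl a) = ricci ρ (Sum.inl a) i :=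
    fun i a ↦ hR _ _
  have hl := hρ.antisymm_left
  have hr := hρ.antisymm_right
  have hp := hρ.pair_symm
  -- Only the fact that this factor is one fixed scalar matters: the trace terms subtracted in the
  -- Weyl part are added back by the Ricci and scalar terms.
  obtain ⟨κ, e1⟩ : ∃ κ, 1 / ((n : ℝ) - 2) = κ := ⟨_, rfl⟩
  have e2 : 2 / ((n : ℝ) - 2) = 2 * κ := by rw [← e1]; ring
  constructor
  · have h := H i0 i1 i1 i0
    simp only [frameCurv_eq, weyl, asym, eta_i0_i0, eta_i1_i1, eta_i0_i1, eta_i1_i0,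
      eta_inl_inr, eta_inr_inl, eta_inr_inr, mul_div_assoc', ← Finset.sum_div, mul_sub,
      Finset.sum_sub_distrib, Finset.sum_add_distrib, Finset.sum_neg_distrib, mul_add, mul_neg,
      neg_mul, h0, h10, hi0, hi1, hR', e1, e2, hR i1 i0, mul_comm (Γ i1 _ _ x) (Γ i0 _ _ x)] at h ⊢
    -- Hypothesis and goal are normalised together. The transverse sums then serve as common atoms,
    -- and the rest is linear up to the symmetries of ρ.
    revert h
    ring_nf
    intro h
    linarith [hr i0 i1 i0 i1]
  · intro i
    have h := H i0 i1 i i0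
    simp only [frameCurv_eq, weyl, asym, eta_i0_i0, eta_i1_i1, eta_i0_i1, eta_i1_i0,
      eta_inl_inr, eta_inr_inl, eta_inr_inr, mul_div_assoc', ← Finset.sum_div, mul_sub,
      Finset.sum_sub_distrib, Finset.sum_add_distrib, Finset.sum_neg_distrib, mul_add, mul_neg,
      neg_mul, h0, h10, hi0, hi1, hR', e1, e2] at h ⊢
    revert h
    ring_nf
    intro h
    linarith [hr i0 i1 i0 i]
  · intro i
    have h := H i0 i1 i i1
    simp only [frameCurv_eq, weyl, asym, eta_i0_i0, eta_i1_i1, eta_i0_i1, eta_i1_i0,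
      eta_inl_inr, eta_inr_inl, eta_inr_inr, mul_div_assoc', ← Finset.sum_div, mul_sub,
      Finset.sum_sub_distrib, Finset.sum_add_distrib, Finset.sum_neg_distrib, mul_add, mul_neg,
      neg_mul, h0, h10, hi0, hi1, hR', e1, e2] at h ⊢
    revert h
    ring_nf
    intro h
    linarith [hl i0 i1 i i1, hr i1 i0 i1 i]
  · intro i j
    have h := H i0 i1 i j
    simp only [frameCurv_eq, weyl, asym, eta_i0_i0, eta_i1_i1, eta_i0_i1, eta_i1_i0,
      eta_inl_inr, eta_inr_inl, eta_inr_inr, mul_div_assoc', ← Finset.sum_div, mul_sub,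
      Finset.sum_sub_distrib, Finset.sum_add_distrib, Finset.sum_neg_distrib, mul_add, mul_neg,
      neg_mul, h0, h10, hi0, hi1, hR', e1, e2] at h ⊢
    revert h
    ring_nf
    intro h
    linarith
  · intro i
    have h := H i0 i i1 i0
    simp only [frameCurv_eq, weyl, asym, eta_i0_i0, eta_i1_i1, eta_i0_i1, eta_i1_i0,
      eta_inl_inr, eta_inr_inl, eta_inr_inr, mul_div_assoc', ← Finset.sum_div, mul_sub,
      Finset.sum_sub_distrib, Finset.sum_add_distrib, Finset.sum_neg_distrib, mul_add, mul_neg,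
      neg_mul, h0, h10, hi0, hi1, hR', e1, e2] at h ⊢
    revert h
    ring_nf
    intro h
    linarith [hp i0 i i1 i0, hl i0 i1 i0 i]
  · intro i
    have h := H i1 i i0 i1
    simp only [frameCurv_eq, weyl, asym, eta_i0_i0, eta_i1_i1, eta_i0_i1, eta_i1_i0,
      eta_inl_inr, eta_inr_inl, eta_inr_inr, mul_div_assoc', ← Finset.sum_div, mul_sub,
      Finset.sum_sub_distrib, Finset.sum_add_distrib, Finset.sum_neg_distrib, mul_add, mul_neg,
      neg_mul, h0, h10, hi0, hi1, hR', e1, e2] at h ⊢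
    revert h
    ring_nf
    intro h
    linarith [hp i1 i i0 i1, hl i0 i1 i1 i]
  · intro i j
    have h := H i0 i j i0
    simp only [frameCurv_eq, weyl, asym, eta_i0_i0, eta_i1_i1, eta_i0_i1, eta_i1_i0,
      eta_inl_inr, eta_inr_inl, eta_inr_inr, mul_div_assoc', ← Finset.sum_div, mul_sub,
      Finset.sum_sub_distrib, Finset.sum_add_distrib, Finset.sum_neg_distrib, mul_add, mul_neg,
      neg_mul, h0, h10, hi0, hi1, hR', e1, e2] at h ⊢
    revert h
    ring_nf
    intro h
    linarith [hr i0 i i0 j]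
  · intro i j
    have h := H i1 i j i1
    simp only [frameCurv_eq, weyl, asym, eta_i0_i0, eta_i1_i1, eta_i0_i1, eta_i1_i0,
      eta_inl_inr, eta_inr_inl, eta_inr_inr, mul_div_assoc', ← Finset.sum_div, mul_sub,
      Finset.sum_sub_distrib, Finset.sum_add_distrib, Finset.sum_neg_distrib, mul_add, mul_neg,
      neg_mul, h0, h10, hi0, hi1, hR', e1, e2] at h ⊢
    revert h
    ring_nf
    intro h
    linarith [hr i1 i i1 j]
  · intro i j
    have h := H i0 i j i1
    simp only [frameCurv_eq, weyl, asym, eta_i0_i0, eta_i1_i1, eta_i0_i1, eta_i1_i0,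
      eta_inl_inr, eta_inr_inl, eta_inr_inr, mul_div_assoc', ← Finset.sum_div, mul_sub,
      Finset.sum_sub_distrib, Finset.sum_add_distrib, Finset.sum_neg_distrib, mul_add, mul_neg,
      neg_mul, h0, h10, hi0, hi1, hR', e1, e2] at h ⊢
    revert h
    ring_nf
    intro h
    linarith [hr i0 i i1 j]
  · intro i j
    have h := H i1 i j i0
    simp only [frameCurv_eq, weyl, asym, eta_i0_i0, eta_i1_i1, eta_i0_i1, eta_i1_i0,
      eta_inl_inr, eta_inr_inl, eta_inr_inr, mul_div_assoc', ← Finset.sum_div, mul_sub,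
      Finset.sum_sub_distrib, Finset.sum_add_distrib, Finset.sum_neg_distrib, mul_add, mul_neg,
      neg_mul, h0, h10, hi0, hi1, hR', e1, e2, hR j i, kron_comm j i] at h ⊢
    revert h
    ring_nf
    intro h
    -- The block is (1i)(j0) while the equation contains C_{0j1i}, so the pairs of ρ have to be
    -- exchanged.
    linarith [hr i1 i i0 j, hp i0 j i1 i]
  · intro i j k
    have h := H i0 i k j
    simp only [frameCurv_eq, weyl, asym, eta_i0_i0, eta_i1_i1, eta_i0_i1, eta_i1_i0,
      eta_inl_inr, eta_inr_inl, eta_inr_inr, mul_div_assoc', ← Finset.sum_div, mul_sub,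
      Finset.sum_sub_distrib, Finset.sum_add_distrib, Finset.sum_neg_distrib, mul_add, mul_neg,
      neg_mul, h0, h10, hi0, hi1, hR', e1, e2, kron_comm k i, kron_comm j i] at h ⊢
    revert h
    ring_nf
    intro h
    linarith [hr i0 i j k]
  · intro i j k
    have h := H i1 i k j
    simp only [frameCurv_eq, weyl, asym, eta_i0_i0, eta_i1_i1, eta_i0_i1, eta_i1_i0,
      eta_inl_inr, eta_inr_inl, eta_inr_inr, mul_div_assoc', ← Finset.sum_div, mul_sub,
      Finset.sum_sub_distrib, Finset.sum_add_distrib, Finset.sum_neg_distrib, mul_add, mul_neg,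
      neg_mul, h0, h10, hi0, hi1, hR', e1, e2, kron_comm k i, kron_comm j i] at h ⊢
    revert h
    ring_nf
    intro h
    linarith [hr i1 i j k]
  · intro i j
    have h := H i j i1 i0
    simp only [frameCurv_eq, weyl, asym, eta_i0_i0, eta_i1_i1, eta_i0_i1, eta_i1_i0,
      eta_inl_inr, eta_inr_inl, eta_inr_inr, mul_div_assoc', ← Finset.sum_div, mul_sub,
      Finset.sum_sub_distrib, Finset.sum_add_distrib, Finset.sum_neg_distrib, mul_add, mul_neg,
      neg_mul, h0, h10, hi0, hi1, hR', e1, e2] at h ⊢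
    revert h
    ring_nf
    intro h
    linarith [hr i j i0 i1, hp i j i0 i1]
  · intro i j k
    have h := H i j k i0
    simp only [frameCurv_eq, weyl, asym, eta_i0_i0, eta_i1_i1, eta_i0_i1, eta_i1_i0,
      eta_inl_inr, eta_inr_inl, eta_inr_inr, mul_div_assoc', ← Finset.sum_div, mul_sub,
      Finset.sum_sub_distrib, Finset.sum_add_distrib, Finset.sum_neg_distrib, mul_add, mul_neg,
      neg_mul, h0, h10, hi0, hi1, hR', e1, e2, kron_comm k i, kron_comm k j] at h ⊢
    revert h
    ring_nf
    intro h
    linarith [hr i j i0 k, hp i j i0 k]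
  · intro i j k
    have h := H i j k i1
    simp only [frameCurv_eq, weyl, asym, eta_i0_i0, eta_i1_i1, eta_i0_i1, eta_i1_i0,
      eta_inl_inr, eta_inr_inl, eta_inr_inr, mul_div_assoc', ← Finset.sum_div, mul_sub,
      Finset.sum_sub_distrib, Finset.sum_add_distrib, Finset.sum_neg_distrib, mul_add, mul_neg,
      neg_mul, h0, h10, hi0, hi1, hR', e1, e2, kron_comm k i, kron_comm k j] at h ⊢
    revert h
    ring_nf
    intro h
    linarith [hr i j i1 k, hp i j i1 k]
  · intro i j k l
    have h := H i j l k
    simp only [frameCurv_eq, weyl, asym, eta_i0_i0, eta_i1_i1, eta_i0_i1, eta_i1_i0,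
      eta_inl_inr, eta_inr_inl, eta_inr_inr, mul_div_assoc', ← Finset.sum_div, mul_sub,
      Finset.sum_sub_distrib, Finset.sum_add_distrib, Finset.sum_neg_distrib, mul_add, mul_neg,
      neg_mul, h0, h10, hi0, hi1, hR', e1, e2, hR l j, hR k j, hR l i, hR k i] at h ⊢
    revert h
    ring_nf
    intro h
    linarith [hr i j k l]

set_option linter.unusedSimpArgs false in
/-- The frame equations imply all contracted Ricci identities. -/
theorem frameCurv_eq_of_ricciSystem (hΓ : ∀ s a b, Γ s a b x = -Γ a s b x)
    {ρ : FIdx n → FIdx n → FIdx n → FIdx n → ℝ} (hρ : IsCurvatureLike ρ)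
    (hd : ∀ s a b c, d c (Γ s a b) x = -d c (Γ a s b) x)
    (H : RicciSystem (d i0) (d i1) (fun i ↦ d i) (Γ i0) (Γ i1) (fun i ↦ Γ i)
      (weyl ρ) (ricci ρ) (scal ρ) x) (s a b c : FIdx n) :
    frameCurv d Γ x s a b c = ρ s a b c := by
  have h0 : ∀ s c, Γ s s c x = 0 := fun s c ↦ by linarith [hΓ s s c]
  have h10 : ∀ c, Γ i1 i0 c x = -Γ i0 i1 c x := fun c ↦ hΓ _ _ _
  have hi0 : ∀ (i : Fin (n - 2)) c, Γ i i0 c x = -Γ i0 i c x := fun i c ↦ hΓ _ _ _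
  have hi1 : ∀ (i : Fin (n - 2)) c, Γ i i1 c x = -Γ i1 i c x := fun i c ↦ hΓ _ _ _
  have hR := hρ.ricci_symm
  have hR' : ∀ (i : Fin (n - 2)) (a : Fin 2), ricci ρ i (Sum.inl a) = ricci ρ (Sum.inl a) i :=
    fun i a ↦ hR _ _
  have hl := hρ.antisymm_left
  have hr := hρ.antisymm_right
  have hp := hρ.pair_symm
  obtain ⟨κ, e1⟩ : ∃ κ, 1 / ((n : ℝ) - 2) = κ := ⟨_, rfl⟩
  have e2 : 2 / ((n : ℝ) - 2) = 2 * κ := by rw [← e1]; ring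
  -- Each equation differs from its block by a linear identity, so the forward computation also runs
  -- backwards, one block at a time.
  have c_L_n_ell_n : frameCurv d Γ x i0 i1 i1 i0 = ρ i0 i1 i1 i0 := by
    have h := H.L_n_ell_n
    simp only [frameCurv_eq, weyl, asym, eta_i0_i0, eta_i1_i1, eta_i0_i1, eta_i1_i0,
      eta_inl_inr, eta_inr_inl, eta_inr_inr, mul_div_assoc', ← Finset.sum_div, mul_sub,
      Finset.sum_sub_distrib, Finset.sum_add_distrib, Finset.sum_neg_distrib, mul_add, mul_neg,
      neg_mul, h0, h10, hi0, hi1, hR', e1, e2, hR i1 i0, mul_comm (Γ i1 _ _ x) (Γ i0 _ _ x)] at h ⊢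
    revert h
    ring_nf
    intro h
    linarith [hr i0 i1 i0 i1]
  have c_L_n_ell_m : ∀ i : Fin (n - 2), frameCurv d Γ x i0 i1 i i0 = ρ i0 i1 i i0 := by
    intro i
    have h := H.L_n_ell_m i
    simp only [frameCurv_eq, weyl, asym, eta_i0_i0, eta_i1_i1, eta_i0_i1, eta_i1_i0,
      eta_inl_inr, eta_inr_inl, eta_inr_inr, mul_div_assoc', ← Finset.sum_div, mul_sub,
      Finset.sum_sub_distrib, Finset.sum_add_distrib, Finset.sum_neg_distrib, mul_add, mul_neg,
      neg_mul, h0, h10, hi0, hi1, hR', e1, e2] at h ⊢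
    revert h
    ring_nf
    intro h
    linarith [hr i0 i1 i0 i]
  have c_N_ell_n_m : ∀ i : Fin (n - 2), frameCurv d Γ x i0 i1 i i1 = ρ i0 i1 i i1 := by
    intro i
    have h := H.N_ell_n_m i
    simp only [frameCurv_eq, weyl, asym, eta_i0_i0, eta_i1_i1, eta_i0_i1, eta_i1_i0,
      eta_inl_inr, eta_inr_inl, eta_inr_inr, mul_div_assoc', ← Finset.sum_div, mul_sub,
      Finset.sum_sub_distrib, Finset.sum_add_distrib, Finset.sum_neg_distrib, mul_add, mul_neg,
      neg_mul, h0, h10, hi0, hi1, hR', e1, e2] at h ⊢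
    revert h
    ring_nf
    intro h
    linarith [hl i0 i1 i i1, hr i1 i0 i1 i]
  have c_L_n_m_m : ∀ i j : Fin (n - 2), frameCurv d Γ x i0 i1 i j = ρ i0 i1 i j := by
    intro i j
    have h := H.L_n_m_m i j
    simp only [frameCurv_eq, weyl, asym, eta_i0_i0, eta_i1_i1, eta_i0_i1, eta_i1_i0,
      eta_inl_inr, eta_inr_inl, eta_inr_inr, mul_div_assoc', ← Finset.sum_div, mul_sub,
      Finset.sum_sub_distrib, Finset.sum_add_distrib, Finset.sum_neg_distrib, mul_add, mul_neg,
      neg_mul, h0, h10, hi0, hi1, hR', e1, e2] at h ⊢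
    revert h
    ring_nf
    intro h
    linarith
  have c_L_m_ell_n : ∀ i : Fin (n - 2), frameCurv d Γ x i0 i i1 i0 = ρ i0 i i1 i0 := by
    intro i
    have h := H.L_m_ell_n i
    simp only [frameCurv_eq, weyl, asym, eta_i0_i0, eta_i1_i1, eta_i0_i1, eta_i1_i0,
      eta_inl_inr, eta_inr_inl, eta_inr_inr, mul_div_assoc', ← Finset.sum_div, mul_sub,
      Finset.sum_sub_distrib, Finset.sum_add_distrib, Finset.sum_neg_distrib, mul_add, mul_neg,
      neg_mul, h0, h10, hi0, hi1, hR', e1, e2] at h ⊢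
    revert h
    ring_nf
    intro h
    linarith [hp i0 i i1 i0, hl i0 i1 i0 i]
  have c_N_m_n_ell : ∀ i : Fin (n - 2), frameCurv d Γ x i1 i i0 i1 = ρ i1 i i0 i1 := by
    intro i
    have h := H.N_m_n_ell i
    simp only [frameCurv_eq, weyl, asym, eta_i0_i0, eta_i1_i1, eta_i0_i1, eta_i1_i0,
      eta_inl_inr, eta_inr_inl, eta_inr_inr, mul_div_assoc', ← Finset.sum_div, mul_sub,
      Finset.sum_sub_distrib, Finset.sum_add_distrib, Finset.sum_neg_distrib, mul_add, mul_neg,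
      neg_mul, h0, h10, hi0, hi1, hR', e1, e2] at h ⊢
    revert h
    ring_nf
    intro h
    linarith [hp i1 i i0 i1, hl i0 i1 i1 i]
  have c_L_m_ell_m : ∀ i j : Fin (n - 2), frameCurv d Γ x i0 i j i0 = ρ i0 i j i0 := by
    intro i j
    have h := H.L_m_ell_m i j
    simp only [frameCurv_eq, weyl, asym, eta_i0_i0, eta_i1_i1, eta_i0_i1, eta_i1_i0,
      eta_inl_inr, eta_inr_inl, eta_inr_inr, mul_div_assoc', ← Finset.sum_div, mul_sub,
      Finset.sum_sub_distrib, Finset.sum_add_distrib, Finset.sum_neg_distrib, mul_add, mul_neg,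
      neg_mul, h0, h10, hi0, hi1, hR', e1, e2] at h ⊢
    revert h
    ring_nf
    intro h
    linarith [hr i0 i i0 j]
  have c_N_m_n_m : ∀ i j : Fin (n - 2), frameCurv d Γ x i1 i j i1 = ρ i1 i j i1 := by
    intro i j
    have h := H.N_m_n_m i j
    simp only [frameCurv_eq, weyl, asym, eta_i0_i0, eta_i1_i1, eta_i0_i1, eta_i1_i0,
      eta_inl_inr, eta_inr_inl, eta_inr_inr, mul_div_assoc', ← Finset.sum_div, mul_sub,
      Finset.sum_sub_distrib, Finset.sum_add_distrib, Finset.sum_neg_distrib, mul_add, mul_neg,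
      neg_mul, h0, h10, hi0, hi1, hR', e1, e2] at h ⊢
    revert h
    ring_nf
    intro h
    linarith [hr i1 i i1 j]
  have c_L_m_n_m : ∀ i j : Fin (n - 2), frameCurv d Γ x i0 i j i1 = ρ i0 i j i1 := by
    intro i j
    have h := H.L_m_n_m i j
    simp only [frameCurv_eq, weyl, asym, eta_i0_i0, eta_i1_i1, eta_i0_i1, eta_i1_i0,
      eta_inl_inr, eta_inr_inl, eta_inr_inr, mul_div_assoc', ← Finset.sum_div, mul_sub,
      Finset.sum_sub_distrib, Finset.sum_add_distrib, Finset.sum_neg_distrib, mul_add, mul_neg,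
      neg_mul, h0, h10, hi0, hi1, hR', e1, e2] at h ⊢
    revert h
    ring_nf
    intro h
    linarith [hr i0 i i1 j]
  have c_N_m_ell_m : ∀ i j : Fin (n - 2), frameCurv d Γ x i1 i j i0 = ρ i1 i j i0 := by
    intro i j
    have h := H.N_m_ell_m i j
    simp only [frameCurv_eq, weyl, asym, eta_i0_i0, eta_i1_i1, eta_i0_i1, eta_i1_i0,
      eta_inl_inr, eta_inr_inl, eta_inr_inr, mul_div_assoc', ← Finset.sum_div, mul_sub,
      Finset.sum_sub_distrib, Finset.sum_add_distrib, Finset.sum_neg_distrib, mul_add, mul_neg,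
      neg_mul, h0, h10, hi0, hi1, hR', e1, e2, hR j i, kron_comm j i] at h ⊢
    revert h
    ring_nf
    intro h
    linarith [hr i1 i i0 j, hp i0 j i1 i]
  have c_L_m_m_m : ∀ i j k : Fin (n - 2), frameCurv d Γ x i0 i k j = ρ i0 i k j := by
    intro i j k
    have h := H.L_m_m_m i j k
    simp only [frameCurv_eq, weyl, asym, eta_i0_i0, eta_i1_i1, eta_i0_i1, eta_i1_i0,
      eta_inl_inr, eta_inr_inl, eta_inr_inr, mul_div_assoc', ← Finset.sum_div, mul_sub,
      Finset.sum_sub_distrib, Finset.sum_add_distrib, Finset.sum_neg_distrib, mul_add, mul_neg,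
      neg_mul, h0, h10, hi0, hi1, hR', e1, e2, kron_comm k i, kron_comm j i] at h ⊢
    revert h
    ring_nf
    intro h
    linarith [hr i0 i j k]
  have c_N_m_m_m : ∀ i j k : Fin (n - 2), frameCurv d Γ x i1 i k j = ρ i1 i k j := by
    intro i j k
    have h := H.N_m_m_m i j k
    simp only [frameCurv_eq, weyl, asym, eta_i0_i0, eta_i1_i1, eta_i0_i1, eta_i1_i0,
      eta_inl_inr, eta_inr_inl, eta_inr_inr, mul_div_assoc', ← Finset.sum_div, mul_sub,
      Finset.sum_sub_distrib, Finset.sum_add_distrib, Finset.sum_neg_distrib, mul_add, mul_neg,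
      neg_mul, h0, h10, hi0, hi1, hR', e1, e2, kron_comm k i, kron_comm j i] at h ⊢
    revert h
    ring_nf
    intro h
    linarith [hr i1 i j k]
  have c_M_m_ell_n : ∀ i j : Fin (n - 2), frameCurv d Γ x i j i1 i0 = ρ i j i1 i0 := by
    intro i j
    have h := H.M_m_ell_n i j
    simp only [frameCurv_eq, weyl, asym, eta_i0_i0, eta_i1_i1, eta_i0_i1, eta_i1_i0,
      eta_inl_inr, eta_inr_inl, eta_inr_inr, mul_div_assoc', ← Finset.sum_div, mul_sub,
      Finset.sum_sub_distrib, Finset.sum_add_distrib, Finset.sum_neg_distrib, mul_add, mul_neg,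
      neg_mul, h0, h10, hi0, hi1, hR', e1, e2] at h ⊢
    revert h
    ring_nf
    intro h
    linarith [hr i j i0 i1, hp i j i0 i1]
  have c_M_m_ell_m : ∀ i j k : Fin (n - 2), frameCurv d Γ x i j k i0 = ρ i j k i0 := by
    intro i j k
    have h := H.M_m_ell_m i j k
    simp only [frameCurv_eq, weyl, asym, eta_i0_i0, eta_i1_i1, eta_i0_i1, eta_i1_i0,
      eta_inl_inr, eta_inr_inl, eta_inr_inr, mul_div_assoc', ← Finset.sum_div, mul_sub,
      Finset.sum_sub_distrib, Finset.sum_add_distrib, Finset.sum_neg_distrib, mul_add, mul_neg,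
      neg_mul, h0, h10, hi0, hi1, hR', e1, e2, kron_comm k i, kron_comm k j] at h ⊢
    revert h
    ring_nf
    intro h
    linarith [hr i j i0 k, hp i j i0 k]
  have c_M_m_n_m : ∀ i j k : Fin (n - 2), frameCurv d Γ x i j k i1 = ρ i j k i1 := by
    intro i j k
    have h := H.M_m_n_m i j k
    simp only [frameCurv_eq, weyl, asym, eta_i0_i0, eta_i1_i1, eta_i0_i1, eta_i1_i0,
      eta_inl_inr, eta_inr_inl, eta_inr_inr, mul_div_assoc', ← Finset.sum_div, mul_sub,
      Finset.sum_sub_distrib, Finset.sum_add_distrib, Finset.sum_neg_distrib, mul_add, mul_neg,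
      neg_mul, h0, h10, hi0, hi1, hR', e1, e2, kron_comm k i, kron_comm k j] at h ⊢
    revert h
    ring_nf
    intro h
    linarith [hr i j i1 k, hp i j i1 k]
  have c_M_m_m_m : ∀ i j k l : Fin (n - 2), frameCurv d Γ x i j l k = ρ i j l k := by
    intro i j k l
    have h := H.M_m_m_m i j k l
    simp only [frameCurv_eq, weyl, asym, eta_i0_i0, eta_i1_i1, eta_i0_i1, eta_i1_i0,
      eta_inl_inr, eta_inr_inl, eta_inr_inr, mul_div_assoc', ← Finset.sum_div, mul_sub,
      Finset.sum_sub_distrib, Finset.sum_add_distrib, Finset.sum_neg_distrib, mul_add, mul_neg,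
      neg_mul, h0, h10, hi0, hi1, hR', e1, e2, hR l j, hR k j, hR l i, hR k i] at h ⊢
    revert h
    ring_nf
    intro h
    linarith [hr i j k l]
  have swap : ∀ {s a b c}, frameCurv d Γ x s a b c = ρ s a b c →
      frameCurv d Γ x s a c b = ρ s a c b := fun {s a b c} h ↦ by
    rw [frameCurv_antisymm_right, hr, h]
  -- Reduction in the first pair, then in the second: the sixteen remaining goals are the blocks, up
  -- to the order of the last two indices.
  refine eq_of_antisymm (f := fun s a ↦ frameCurv d Γ x s a b c) (g := fun s a ↦ ρ s a b c)
    (fun _ _ ↦ frameCurv_antisymm_left hΓ hd _ _ _ _) (fun _ _ ↦ hl _ _ _ _)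
    ?_ (fun i ↦ ?_) (fun i ↦ ?_) (fun i j ↦ ?_) s a
  all_goals
    refine eq_of_antisymm (f := frameCurv d Γ x _ _) (g := ρ _ _)
      (fun _ _ ↦ frameCurv_antisymm_right _ _ _ _) (fun _ _ ↦ hr _ _ _ _)
      ?_ (fun k ↦ ?_) (fun k ↦ ?_) (fun k l ↦ ?_) b c
  · exact swap c_L_n_ell_n
  · exact swap (c_L_n_ell_m _)
  · exact swap (c_N_ell_n_m _)
  · exact c_L_n_m_m _ _
  · exact swap (c_L_m_ell_n _)
  · exact swap (c_L_m_ell_m _ _)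
  · exact swap (c_L_m_n_m _ _)
  · exact swap (c_L_m_m_m _ _ _)
  · exact c_N_m_n_ell _
  · exact swap (c_N_m_ell_m _ _)
  · exact swap (c_N_m_n_m _ _)
  · exact swap (c_N_m_m_m _ _ _)
  · exact swap (c_M_m_ell_n _ _)
  · exact swap (c_M_m_ell_m _ _ _)
  · exact swap (c_M_m_n_m _ _ _)
  · exact swap (c_M_m_m_m _ _ _ _)

end FrameAlgebra

/-! ### Levi-Civita connection: locality, Ricci identity, first Bianchi identity -/

variable {E : Type*} [NormedAddCommGroup E] [NormedSpace ℝ E]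
  {M : Type*} [TopologicalSpace M] [ChartedSpace E M]

namespace LorentzMetric

theorem dirDeriv_congr {f f' : M → ℝ} {x : M} (h : f =ᶠ[𝓝 x] f') (X : VField E M) :
    dirDeriv X f x = dirDeriv X f' x := by
  change mfderiv 𝓘(ℝ, E) 𝓘(ℝ, ℝ) f x (X x) = mfderiv 𝓘(ℝ, E) 𝓘(ℝ, ℝ) f' x (X x)
  rw [h.mfderiv_eq]
  rfl

theorem dirDeriv_eq_zero {f : M → ℝ} {c : ℝ} {x : M} (h : ∀ᶠ y in 𝓝 x, f y = c)
    (X : VField E M) : dirDeriv X f x = 0 := by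
  rw [dirDeriv_congr (f' := fun _ ↦ c) h, dirDeriv, mvfderiv_const]
  rfl

theorem dirDeriv_neg (f : M → ℝ) (X : VField E M) (x : M) :
    dirDeriv X (fun y ↦ -f y) x = -dirDeriv X f x := by
  change mvfderiv 𝓘(ℝ, E) (-f) x (X x) = _
  rw [mvfderiv_neg]
  rfl

variable [IsManifold 𝓘(ℝ, E) ∞ M] (g : LorentzMetric E M)

theorem contMDiffAt_pair {X Y : VField E M} {x : M}
    (hX : CMDiffAt ∞ (T% X) x) (hY : CMDiffAt ∞ (T% Y) x) : CMDiffAt ∞ (g.pair X Y) x := by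
  have := ContMDiffAt.clm_bundle_apply₂ (F₁ := E)
    (F₂ := E) (F₃ := ℝ) (E₃ := Bundle.Trivial M ℝ) g.contMDiff.contMDiffAt hX hY
  exact ((Bundle.contMDiffAt_totalSpace).1 this).2

variable [FiniteDimensional ℝ E]

theorem contMDiffAt_mlieBracket {X Y : VField E M} {x : M}
    (hX : CMDiffAt ∞ (T% X) x) (hY : CMDiffAt ∞ (T% Y) x) :
    CMDiffAt ∞ (T% (VectorField.mlieBracket 𝓘(ℝ, E) X Y)) x := by
  have := FiniteDimensional.complete ℝ E
  have : IsManifold 𝓘(ℝ, E) (minSmoothness ℝ 2) M :=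
    .of_le (n := ∞) (by simpa using WithTop.coe_le_coe.2 (le_top : (2 : ℕ∞) ≤ ⊤))
  -- Here ∞ + 1 = ∞, so the bracket loses no smoothness.
  have : IsManifold 𝓘(ℝ, E) (((⊤ : ℕ∞) : WithTop ℕ∞) + 1) M := ‹IsManifold 𝓘(ℝ, E) ∞ M›
  exact ContMDiffAt.mlieBracket_vectorField (m := ⊤) (n := ⊤) hX hY (by simp)

theorem cov_congr {Y Y' : VField E M} {x : M} (h : ∀ᶠ y in 𝓝 x, Y y = Y' y)
    (hY : MDiffAt (T% Y) x) (hY' : MDiffAt (T% Y') x) (X : VField E M) :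
    g.cov X Y x = g.cov X Y' x := by
  rw [cov, cov, g.leviCivita.isCovariantDerivativeOnUniv.congr_of_eventuallyEq hY hY'
    Filter.univ_mem h]

theorem cov_sub {X Y Y' : VField E M} {x : M}
    (hY : MDiffAt (T% Y) x) (hY' : MDiffAt (T% Y') x) :
    g.cov X (Y - Y') x = g.cov X Y x - g.cov X Y' x := by
  have h := g.leviCivita.isCovariantDerivativeOnUniv
  have hn : MDiffAt (T% ((-1 : ℝ) • Y')) x := mdifferentiableAt_const.smul_section hY'
  have e : Y - Y' = Y + (-1 : ℝ) • Y' := by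
    rw [neg_one_smul, sub_eq_add_neg]
  rw [e, cov, h.add hY hn, h.smul_const (-1 : ℝ) hY']
  simp [cov, sub_eq_add_neg]

/-- The correction terms leave the derivative of v along ∇_Y Z - ∇_Z Y, which is -[Z, Y] as torsion
vanishes. -/
theorem cov2_sub_cov2 {v Y Z : VField E M} {x : M} (hY : MDiffAt (T% Y) x)
    (hZ : MDiffAt (T% Z) x) :
    g.cov2 v Y Z x - g.cov2 v Z Y x = g.curv Z Y v x := by
  have h : g.cov (VectorField.mlieBracket 𝓘(ℝ, E) Z Y) v x
      = g.cov (g.cov Z Y) v x - g.cov (g.cov Y Z) v x := by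
    simp only [cov, ← g.leviCivita_torsionFree hZ hY, map_sub]
  simp only [cov2, curv, Pi.sub_apply, h]
  abel

/-- The first Bianchi identity. -/
theorem curv_cyclic {X Y Z : VField E M} {x : M} (hX : ∀ᶠ y in 𝓝 x, CMDiffAt ∞ (T% X) y)
    (hY : ∀ᶠ y in 𝓝 x, CMDiffAt ∞ (T% Y) y) (hZ : ∀ᶠ y in 𝓝 x, CMDiffAt ∞ (T% Z) y)
    (hXY : MDiffAt (T% (g.cov X Y)) x) (hYX : MDiffAt (T% (g.cov Y X)) x)
    (hYZ : MDiffAt (T% (g.cov Y Z)) x) (hZY : MDiffAt (T% (g.cov Z Y)) x)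
    (hZX : MDiffAt (T% (g.cov Z X)) x) (hXZ : MDiffAt (T% (g.cov X Z)) x) :
    g.curv X Y Z x + g.curv Y Z X x + g.curv Z X Y x = 0 := by
  have := FiniteDimensional.complete ℝ E
  have h2 : (2 : WithTop ℕ∞) ≤ ∞ := WithTop.coe_le_coe.2 (le_top : (2 : ℕ∞) ≤ ⊤)
  have h3 : (3 : WithTop ℕ∞) ≤ ∞ := WithTop.coe_le_coe.2 (le_top : (3 : ℕ∞) ≤ ⊤)
  have : IsManifold 𝓘(ℝ, E) (minSmoothness ℝ 3) M := .of_le (n := ∞) (by simpa using h3)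
  -- Torsion-freeness is used twice: near x it turns ∇_B C - ∇_C B into [B, C], then at x it gives
  -- ∇_A [B, C] = ∇_{[B,C]} A + [A, [B, C]]. Grouping the cyclic sum by outer derivative leaves only
  -- double brackets, which cancel by Jacobi.
  have aux : ∀ {A B C : VField E M}, (∀ᶠ y in 𝓝 x, CMDiffAt ∞ (T% A) y) →
      (∀ᶠ y in 𝓝 x, CMDiffAt ∞ (T% B) y) → (∀ᶠ y in 𝓝 x, CMDiffAt ∞ (T% C) y) →
      MDiffAt (T% (g.cov B C)) x → MDiffAt (T% (g.cov C B)) x →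
      g.cov A (g.cov B C) x - g.cov A (g.cov C B) x
        = g.cov (VectorField.mlieBracket 𝓘(ℝ, E) B C) A x
          + VectorField.mlieBracket 𝓘(ℝ, E) A (VectorField.mlieBracket 𝓘(ℝ, E) B C) x := by
    intro A B C hA hB hC hBC hCB
    have hb := (contMDiffAt_mlieBracket hB.self_of_nhds hC.self_of_nhds).mdifferentiableAt
      (by simp)
    have ev : ∀ᶠ y in 𝓝 x,
        (g.cov B C - g.cov C B) y = VectorField.mlieBracket 𝓘(ℝ, E) B C y := by
      filter_upwards [hB, hC] with y h1 h2
      exact g.leviCivita_torsionFree (h1.mdifferentiableAt (by simp))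
        (h2.mdifferentiableAt (by simp))
    rw [← g.cov_sub hBC hCB, g.cov_congr ev (mdifferentiableAt_sub_section hBC hCB) hb,
      ← g.leviCivita_torsionFree (hA.self_of_nhds.mdifferentiableAt (by simp)) hb]
    abel
  have hJ := VectorField.leibniz_identity_mlieBracket_apply (I := 𝓘(ℝ, E)) (U := X) (V := Y)
    (W := Z) (x := x) (hX.self_of_nhds.of_le (by simpa using h2))
    (hY.self_of_nhds.of_le (by simpa using h2)) (hZ.self_of_nhds.of_le (by simpa using h2))
  rw [VectorField.mlieBracket_swap_apply (W := Z)] at hJ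
  have e1 := aux hX hY hZ hYZ hZY
  have e2 := aux hY hX hZ hXZ hZX
  have e3 := aux hZ hX hY hXY hYX
  have e4 : g.cov (VectorField.mlieBracket 𝓘(ℝ, E) X Z) Y x
      = -g.cov (VectorField.mlieBracket 𝓘(ℝ, E) Z X) Y x := by
    simp only [cov, VectorField.mlieBracket_swap_apply (V := X) (W := Z), map_neg]
  simp only [curv, Pi.sub_apply]
  linear_combination (norm := module) e1 - e2 + e3 - e4 + hJ

end LorentzMetric

/-! ### Null frames: expansion, rotation coefficients and curvature components -/

namespace NullFrame

variable [IsManifold 𝓘(ℝ, E) ∞ M] {g : LorentzMetric E M} {n : ℕ} {U : Set M} (F : NullFrame g n U)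

theorem pair_e {x : M} (hx : x ∈ U) (a b : FIdx n) : g.pair (F.e a) (F.e b) x = eta n a b := by
  have h10 : g.pair F.nn F.ell x = 1 := by rw [g.pair_symm]; exact F.ell_nn x hx
  rcases a with a | i <;> rcases b with b | j
  · fin_cases a <;> fin_cases b
    · simpa [e, eta] using F.ell_ell x hx
    · simpa [e, eta] using F.ell_nn x hx
    · simpa [e, eta] using h10
    · simpa [e, eta] using F.nn_nn x hx
  · fin_cases a
    · exact F.ell_mm j x hx
    · exact F.nn_mm j x hx
  · rw [g.pair_symm]
    fin_cases b
    · exact F.ell_mm i x hx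
    · exact F.nn_mm i x hx
  · exact F.mm_mm i j x hx

theorem contMDiffAt_e (hU : IsOpen U) {x : M} (hx : x ∈ U) (a : FIdx n) :
    CMDiffAt ∞ (T% (F.e a)) x := by
  have hn := hU.mem_nhds hx
  rcases a with a | i
  · fin_cases a
    · exact (F.smooth_ell x hx).contMDiffAt hn
    · exact (F.smooth_nn x hx).contMDiffAt hn
  · exact (F.smooth_mm i x hx).contMDiffAt hn

theorem mdifferentiableAt_e (hU : IsOpen U) {x : M} (hx : x ∈ U) (a : FIdx n) :
    MDiffAt (T% (F.e a)) x :=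
  (F.contMDiffAt_e hU hx a).mdifferentiableAt (by simp)

variable [FiniteDimensional ℝ E]

/-- Expansion of a tangent vector in the frame. -/
theorem eq_sum (hn : 3 ≤ n) (hdim : Module.finrank ℝ E = n) {x : M} (hx : x ∈ U)
    (v : TangentSpace 𝓘(ℝ, E) x) :
    v = ∑ p, ∑ q, (eta n p q * g.val x v (F.e p x)) • F.e q x := by
  -- Pairing a linear relation with the frame multiplies its coefficients by the Gram matrix, which
  -- is its own inverse.
  have hli : LinearIndependent ℝ (fun a ↦ F.e a x) := by
    rw [Fintype.linearIndependent_iff]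
    intro c hc a
    have h1 : ∀ b, ∑ p, c p * eta n p b = 0 := fun b ↦ by
      have := congrArg (fun w ↦ g.val x w (F.e b x)) hc
      simpa [sum_apply, ← F.pair_e hx, LorentzMetric.pair] using this
    have h2 : ∑ b, (∑ p, c p * eta n p b) * eta n b a = c a := by
      simp only [Finset.sum_mul]
      rw [Finset.sum_comm]
      simp only [mul_assoc, ← Finset.mul_sum, sum_eta_mul_eta]
      simp
    rw [← h2]
    simp [h1]
  -- With truncated subtraction, 2 + (n - 2) = n relies on the bound on n.
  have hcard : Fintype.card (FIdx n) = Module.finrank ℝ (TangentSpace 𝓘(ℝ, E) x) := by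
    change _ = Module.finrank ℝ E
    rw [hdim]
    simp
    omega
  have hspan := hli.span_eq_top_of_card_eq_finrank' hcard
  rw [← sub_eq_zero]
  refine g.eq_zero_of_forall x _ fun w ↦ ?_
  have hw : w ∈ Submodule.span ℝ (Set.range fun a ↦ F.e a x) := hspan ▸ Submodule.mem_top
  induction hw using Submodule.span_induction with
  | zero => simp
  | add u w _ _ hu hw => rw [map_add, hu, hw, add_zero]
  | smul c w _ hw => rw [map_smul, hw, smul_zero]
  | mem w hw =>
    obtain ⟨a, rfl⟩ := hw
    have h : ∀ q, g.val x (F.e q x) (F.e a x) = eta n q a := fun q ↦ F.pair_e hx q a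
    simp only [map_sub, map_sum, map_smul, sub_apply, sum_apply, smul_apply,
      smul_eq_mul, h]
    have : ∀ p, ∑ q, eta n p q * g.val x v (F.e p x) * eta n q a
        = if p = a then g.val x v (F.e p x) else 0 := fun p ↦ by
      simp only [mul_right_comm _ (g.val x v _), ← Finset.sum_mul, sum_eta_mul_eta, ite_mul,
        one_mul, zero_mul]
    simp [this]

theorem val_eq_sum (hn : 3 ≤ n) (hdim : Module.finrank ℝ E = n) {x : M} (hx : x ∈ U)
    (v w : TangentSpace 𝓘(ℝ, E) x) :
    g.val x v w = ∑ p, ∑ q, eta n p q * (g.val x v (F.e p x) * g.val x w (F.e q x)) := by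
  conv_lhs => rw [F.eq_sum hn hdim hx v]
  simp only [map_sum, map_smul, sum_apply, smul_apply, smul_eq_mul, g.symm x w, mul_assoc]

/-- The products of frame vectors are constant on the open set U, so the derivative terms of the
Koszul formula vanish. Smoothness and antisymmetry of the coefficients are both read off from this
expression. -/
theorem comp_eq (hU : IsOpen U) {x : M} (hx : x ∈ U) (s a b : FIdx n) :
    F.comp (F.e s) a b x =
      (g.pair (VectorField.mlieBracket 𝓘(ℝ, E) (F.e b) (F.e s)) (F.e a) x
        - g.pair (VectorField.mlieBracket 𝓘(ℝ, E) (F.e b) (F.e a)) (F.e s) x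
        - g.pair (VectorField.mlieBracket 𝓘(ℝ, E) (F.e s) (F.e a)) (F.e b) x) / 2 := by
  have h := F.mdifferentiableAt_e hU hx
  have h0 : ∀ a b c, LorentzMetric.dirDeriv (F.e c) (g.pair (F.e a) (F.e b)) x = 0 :=
    fun a b c ↦ LorentzMetric.dirDeriv_eq_zero
      (Filter.mem_of_superset (hU.mem_nhds hx) fun _ hy ↦ F.pair_e hy a b) _
  rw [comp, g.val_cov (h b) (h s) (h a), LorentzMetric.koszul, h0, h0, h0]
  simp [LorentzMetric.pair]

/-- The rotation coefficients are smooth. -/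
theorem contMDiffAt_comp (hU : IsOpen U) {x : M} (hx : x ∈ U) (s a b : FIdx n) :
    CMDiffAt ∞ (F.comp (F.e s) a b) x := by
  have h := F.contMDiffAt_e hU hx
  have hp : ∀ s a b,
      CMDiffAt ∞ (g.pair (VectorField.mlieBracket 𝓘(ℝ, E) (F.e b) (F.e s)) (F.e a)) x :=
    fun s a b ↦ g.contMDiffAt_pair (LorentzMetric.contMDiffAt_mlieBracket (h b) (h s)) (h a)
  refine ContMDiffAt.congr_of_eventuallyEq
    ((((hp s a b).sub (hp a s b)).sub (hp a b s)).div_const 2)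
    (Filter.mem_of_superset (hU.mem_nhds hx) fun y hy ↦ F.comp_eq hU hy s a b)

theorem comp_antisymm (hU : IsOpen U) {x : M} (hx : x ∈ U) (s a b : FIdx n) :
    F.comp (F.e s) a b x = -F.comp (F.e a) s b x := by
  rw [F.comp_eq hU hx, F.comp_eq hU hx]
  simp only [LorentzMetric.pair, VectorField.mlieBracket_swap_apply (V := F.e a) (W := F.e s),
    map_neg, neg_apply]
  ring

/-- Antisymmetry of the coefficients holds on a whole neighbourhood, U being open, and can be
differentiated. -/
theorem dirDeriv_comp_antisymm (hU : IsOpen U) {x : M} (hx : x ∈ U) (s a b c : FIdx n) :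
    LorentzMetric.dirDeriv (F.e c) (F.comp (F.e s) a b) x
      = -LorentzMetric.dirDeriv (F.e c) (F.comp (F.e a) s b) x := by
  rw [← LorentzMetric.dirDeriv_neg]
  exact LorentzMetric.dirDeriv_congr
    (Filter.mem_of_superset (hU.mem_nhds hx) fun y hy ↦ F.comp_antisymm hU hy s a b) _

/-- The connection is defined pointwise, so regularity of ∇_b e_s has to be shown: its expansion in
the smooth frame has the smooth rotation coefficients as coefficients. -/
theorem mdifferentiableAt_cov (hn : 3 ≤ n) (hdim : Module.finrank ℝ E = n) (hU : IsOpen U)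
    {x : M} (hx : x ∈ U) (s b : FIdx n) : MDiffAt (T% (g.cov (F.e b) (F.e s))) x := by
  have h : CMDiffAt ∞ (fun y ↦ Bundle.TotalSpace.mk' E y
      (∑ p, ∑ q, (eta n p q * F.comp (F.e s) p b y) • F.e q y)) x :=
    .sum_section fun p _ ↦ .sum_section fun q _ ↦
      (contMDiffAt_const.mul (F.contMDiffAt_comp hU hx s p b)).smul_section (F.contMDiffAt_e hU hx q)
  refine (h.congr_of_eventuallyEq ?_).mdifferentiableAt (by simp)
  filter_upwards [hU.mem_nhds hx] with y hy
  rw [F.eq_sum hn hdim hy (g.cov (F.e b) (F.e s) y)]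
  rfl

theorem comm2_eq_frameCurv (hn : 3 ≤ n) (hdim : Module.finrank ℝ E = n) (hU : IsOpen U)
    {x : M} (hx : x ∈ U) (s a b c : FIdx n) :
    F.comm2 x s a b c = frameCurv (fun c ↦ LorentzMetric.dirDeriv (F.e c))
      (fun s ↦ F.comp (F.e s)) x s a b c := by
  have hE := F.mdifferentiableAt_e hU hx
  -- Metric compatibility, applied to g(∇_b e_s, e_a) = Γ_{sab}, moves the outer derivative onto the
  -- coefficient. The leftover g(∇_b e_s, ∇_c e_a) is expanded in the frame, and its sign comes from
  -- Γ_{aqc} = -Γ_{qac}.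
  have h1 : ∀ b c, g.val x (g.cov (F.e c) (g.cov (F.e b) (F.e s)) x) (F.e a x)
      = LorentzMetric.dirDeriv (F.e c) (F.comp (F.e s) a b) x
        + ∑ p, ∑ q, eta n p q * (F.comp (F.e s) p b x * F.comp (F.e q) a c x) := fun b c ↦ by
    have h := g.leviCivita_metric (hE c) (F.mdifferentiableAt_cov hn hdim hU hx s b) (hE a)
    rw [F.val_eq_sum hn hdim hx (g.cov (F.e b) (F.e s) x)] at h
    have h' : ∀ q, g.val x (g.cov (F.e c) (F.e a) x) (F.e q x) = -F.comp (F.e q) a c x :=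
      fun q ↦ F.comp_antisymm hU hx a q c
    simp only [h', mul_neg, Finset.sum_neg_distrib] at h
    exact eq_add_of_sub_eq h.symm
  -- The direction ∇_c e_b is expanded in the frame; moving its index b into second place costs the
  -- minus sign.
  have h2 : ∀ b c, g.val x (g.cov (g.cov (F.e c) (F.e b)) (F.e s) x) (F.e a x)
      = -∑ p, ∑ q, eta n p q * (F.comp (F.e p) b c x * F.comp (F.e s) a q x) := fun b c ↦ by
    have h := F.eq_sum hn hdim hx (g.cov (F.e c) (F.e b) x)
    have h' : ∀ q, g.val x (g.cov (F.e c) (F.e b) x) (F.e q x) = -F.comp (F.e q) b c x :=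
      fun q ↦ F.comp_antisymm hU hx b q c
    rw [LorentzMetric.cov, h]
    simp only [h', map_sum, map_smul, sum_apply, smul_apply, smul_eq_mul, mul_neg, neg_mul,
      Finset.sum_neg_distrib, mul_assoc]
    rfl
  simp only [comm2, LorentzMetric.cov2, Pi.sub_apply, map_sub, sub_apply, h1, h2, frameCurv,
    mul_sub, sub_mul, Finset.sum_sub_distrib]
  ring

theorem comm2_eq_R (hU : IsOpen U) {x : M} (hx : x ∈ U) (s a b c : FIdx n) :
    F.comm2 x s a b c = F.R x s a b c := by
  have hE := F.mdifferentiableAt_e hU hx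
  rw [comm2, g.cov2_sub_cov2 (hE b) (hE c)]
  rfl

theorem isCurvatureLike_R (hn : 3 ≤ n) (hdim : Module.finrank ℝ E = n) (hU : IsOpen U)
    {x : M} (hx : x ∈ U) : IsCurvatureLike (F.R x) := by
  have hK : ∀ s a b c, F.R x s a b c = _ := fun s a b c ↦
    (F.comm2_eq_R hU hx s a b c).symm.trans (F.comm2_eq_frameCurv hn hdim hU hx s a b c)
  have hl : ∀ a b c d, F.R x b a c d = -F.R x a b c d := fun a b c d ↦ by
    rw [hK, hK]
    exact frameCurv_antisymm_left (F.comp_antisymm hU hx) (F.dirDeriv_comp_antisymm hU hx) _ _ _ _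
  refine ⟨hl, fun a b c d ↦ by rw [hK, hK]; exact frameCurv_antisymm_right _ _ _ _,
    fun a b c d ↦ ?_⟩
  have hE : ∀ a, ∀ᶠ y in 𝓝 x, CMDiffAt ∞ (T% (F.e a)) y := fun a ↦
    Filter.mem_of_superset (hU.mem_nhds hx) fun y hy ↦ F.contMDiffAt_e hU hy a
  have hC := F.mdifferentiableAt_cov hn hdim hU hx
  have h := g.curv_cyclic (hE d) (hE c) (hE b) (hC _ _) (hC _ _) (hC _ _) (hC _ _) (hC _ _)
    (hC _ _)
  have h' := congrArg (fun v ↦ g.val x v (F.e a x)) h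
  simp only [map_add, add_apply, map_zero, zero_apply] at h'
  -- The cyclic sum of operators permutes the indices b, c, d, one of which is the differentiated
  -- field, and pairs the result with e_a. Flipping the first pair puts a in that position in all
  -- three terms.
  rw [← neg_eq_zero, neg_add, neg_add, ← hl, ← hl, ← hl]
  simp only [R, LorentzMetric.riem]
  linarith

theorem ricciSystem_iff (hU : IsOpen U) (hn : 3 ≤ n) (hdim : Module.finrank ℝ E = n)
    {x : M} (hx : x ∈ U) {ρ : FIdx n → FIdx n → FIdx n → FIdx n → ℝ} (hρ : IsCurvatureLike ρ) :
    (∀ s a b c, F.comm2 x s a b c = ρ s a b c) ↔ F.ricciSystem ρ x := by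
  simp only [F.comm2_eq_frameCurv hn hdim hU hx]
  have hΓ := F.comp_antisymm hU hx
  exact ⟨fun h ↦ ricciSystem_of_frameCurv_eq
      (d := fun c ↦ LorentzMetric.dirDeriv (F.e c)) (Γ := fun s ↦ F.comp (F.e s)) hΓ hρ h,
    fun h ↦ frameCurv_eq_of_ricciSystem
      (d := fun c ↦ LorentzMetric.dirDeriv (F.e c)) (Γ := fun s ↦ F.comp (F.e s)) hΓ hρ
      (F.dirDeriv_comp_antisymm hU hx) h⟩

end NullFrame
end HDNP

/-! ### The main theorem -/

theorem mainTheorem1 {E : Type*} [NormedAddCommGroup E] [NormedSpace ℝ E] [FiniteDimensional ℝ E]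
    {M : Type*} [TopologicalSpace M] [ChartedSpace E M] [IsManifold 𝓘(ℝ, E) ∞ M]
    (n : ℕ) (hn : 3 ≤ n) (hdim : Module.finrank ℝ E = n)
    (g : HDNP.LorentzMetric E M) (U : Set M) (hU : IsOpen U) (F : HDNP.NullFrame g n U) :
    -- the rotation coefficients are smooth
    (∀ a b : HDNP.FIdx n, CMDiff[U] ∞ (F.rotL a b) ∧ CMDiff[U] ∞ (F.rotN a b) ∧
      ∀ i, CMDiff[U] ∞ (F.rotM i a b)) ∧
    ∀ x ∈ U,
      -- the Ricci identities `v_{a;bc} - v_{a;cb} = R_{sabc} v^s` for the frame vectors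
      (∀ s a b c : HDNP.FIdx n, F.comm2 x s a b c = F.R x s a b c) ∧
      -- the frame equations
      F.ricciSystem (F.R x) x ∧
      -- the frame equations exhaust all contractions of the Ricci identities
      (∀ ρ : HDNP.FIdx n → HDNP.FIdx n → HDNP.FIdx n → HDNP.FIdx n → ℝ, HDNP.IsCurvatureLike ρ →
        ((∀ s a b c, F.comm2 x s a b c = ρ s a b c) ↔ F.ricciSystem ρ x)) := by
  refine ⟨fun a b ↦ ⟨fun x hx ↦ (F.contMDiffAt_comp hU hx HDNP.i0 a b).contMDiffWithinAt,
      fun x hx ↦ (F.contMDiffAt_comp hU hx HDNP.i1 a b).contMDiffWithinAt,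
      fun i x hx ↦ (F.contMDiffAt_comp hU hx (Sum.inr i) a b).contMDiffWithinAt⟩, fun x hx ↦ ?_⟩
  have hR := F.comm2_eq_R hU hx
  -- The equations for the metric are the instance of the equivalence in which ρ is its own Riemann
  -- tensor.
  exact ⟨hR, (F.ricciSystem_iff hU hn hdim hx (F.isCurvatureLike_R hn hdim hU hx)).1 hR,
    fun ρ hρ ↦ F.ricciSystem_iff hU hn hdim hx hρ⟩
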